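/- **Theorem (Existence and uniqueness).** Let $a,b,k_1,k_2,k_3,k_4>0$, let $H^1_L(0,1)=\{f\in H^1(0,1): f(0)=0\}$ (complex-valued functions), and let $$\mathcal H = H^1_L(0,1)\times L^2(0,1)\times H^1_L(0,1)\times L^2(0,1)\times\mathbb C\times\mathbb C$$ be the Hilbert space with the inner product $$\langle U,U_1\rangle=\int_0^1\Big(v\overline{v_1}+b^{-1}z\overline{z_1}+ab^{-1}y_x\overline{y_{1x}}+(u_x+y)\overline{(u_{1x}+y_1)}\Big)dx+\frac1{k_1}\eta\overline{\eta_1}+\frac1{k_3}\gamma\overline{\gamma_1}$$ for $U=(u,v,y,z,\eta,\gamma)$ and $U_1=(u_1,v_1,y_1,z_1,\eta_1,\gamma_1)$. Let $\mathcal A$ be the unbounded operator on $\mathcal H$ with domain $$D(\mathcal A)=\{(u,v,y,z,\eta,\gamma)\in\mathcal H:\ u,y\in H^2(0,1),\ v,z\in H^1_L(0,1),\ \eta=v(1),\ \gamma=z(1)\},$$ endowed with the graph norm, and $$\mathcal A U=\big(v,\,(u_x+y)_x,\,z,\,ay_{xx}-b(u_x+y),\,-k_1(u_x(1)+y(1))-k_2\eta,\,-k_3y_x(1)-k_4\gamma\big).$$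 Consider the problem $$(P)\qquad U_t(t)=\mathcal A U(t)\ \ (t>0),\qquad U(0)=U_0 .$$ (1) For every $U_0\in\mathcal H$, problem $(P)$ has a unique mild solution $U\in C^0(\mathbb R_+,\mathcal H)$, i.e. there is a unique $U\in C^0(\mathbb R_+,\mathcal H)$ such that, for all $t\ge 0$, $\int_0^tU(s)\,ds\in D(\mathcal A)$ and $U(t)=U_0+\mathcal A\int_0^tU(s)\,ds$. (2) If $U_0\in D(\mathcal A)$, then this mild solution satisfies $U\in C^0(\mathbb R_+,D(\mathcal A))\cap C^1(\mathbb R_+,\mathcal H)$ and solves $(P)$ in the classical sense, and it is the only classical solution of $(P)$ in this class. -/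

import Mathlib

open MeasureTheory Set
open scoped ContDiff ComplexConjugate

noncomputable section

namespace Timoshenko

/-! ### Function spaces on the interval `(0, 1)` -/

/-- The complex Lebesgue space `L²(0, 1)`. -/
abbrev L2 : Type := Lp ℂ 2 (volume.restrict (Ioo (0 : ℝ) 1))

/-- `φ` is a (real-valued) test function on `(0, 1)`: smooth with compact support in `(0, 1)`. -/
def IsTest (φ : ℝ → ℝ) : Prop :=
  ContDiff ℝ ∞ φ ∧ HasCompactSupport φ ∧ tsupport φ ⊆ Ioo 0 1

/-- `g` is the weak (distributional) derivative of `f` on `(0, 1)`. -/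
def HasWeakDeriv (f g : ℝ → ℂ) : Prop :=
  ∀ φ : ℝ → ℝ, IsTest φ →
    ∫ x in Ioo (0 : ℝ) 1, deriv φ x • f x = - ∫ x in Ioo (0 : ℝ) 1, φ x • g x

/-- The function on `ℝ` which extends a continuous function on `[0, 1]` by constants. -/
def ext (f : C(Icc (0 : ℝ) 1, ℂ)) : ℝ → ℂ := IccExtend zero_le_one f

theorem continuous_ext (f : C(Icc (0 : ℝ) 1, ℂ)) : Continuous (ext f) :=
  f.continuous.Icc_extend'

theorem ext_of_mem (f : C(Icc (0 : ℝ) 1, ℂ)) {x : ℝ} (hx : x ∈ Icc (0 : ℝ) 1) :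
    ext f x = f ⟨x, hx⟩ := IccExtend_of_mem _ _ hx

theorem integrableOn_of_continuous {E : Type*} [NormedAddCommGroup E] {f : ℝ → E}
    (hf : Continuous f) : Integrable f (volume.restrict (Ioo (0 : ℝ) 1)) :=
  (hf.continuousOn.integrableOn_Icc).mono_set Ioo_subset_Icc_self

theorem memLp_ext (f : C(Icc (0 : ℝ) 1, ℂ)) :
    MemLp (ext f) 2 (volume.restrict (Ioo (0 : ℝ) 1)) := by
  refine MemLp.of_bound (continuous_ext f).aestronglyMeasurable ‖f‖ (ae_of_all _ fun x => ?_)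
  exact f.norm_coe_le_norm _

/-- The class in `L²(0, 1)` of a continuous function on `[0, 1]`. -/
def contToL2 : C(Icc (0 : ℝ) 1, ℂ) →ₗ[ℂ] L2 where
  toFun f := (memLp_ext f).toLp (ext f)
  map_add' f g := by
    exact MemLp.toLp_add (memLp_ext f) (memLp_ext g)
  map_smul' c f := by
    exact MemLp.toLp_const_smul c (memLp_ext f)

theorem contToL2_coe (f : C(Icc (0 : ℝ) 1, ℂ)) :
    contToL2 f =ᵐ[volume.restrict (Ioo (0 : ℝ) 1)] ext f := (memLp_ext f).coeFn_toLp

theorem contToL2_injective : Function.Injective contToL2 := by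
  intro f g h
  have h1 : ext f =ᵐ[volume.restrict (Ioo (0 : ℝ) 1)] ext g := by
    have := contToL2_coe f
    rw [h] at this
    exact this.symm.trans (contToL2_coe g)
  have h2 : ext f =ᵐ[volume.restrict (Icc (0 : ℝ) 1)] ext g := by
    rwa [← restrict_Ioo_eq_restrict_Icc]
  have h3 := Measure.eqOn_Icc_of_ae_eq volume zero_ne_one h2
    (continuous_ext f).continuousOn (continuous_ext g).continuousOn
  ext x
  have := h3 x.2
  rwa [ext_of_mem f x.2, ext_of_mem g x.2] at this

theorem integrable_L2 (g : L2) : Integrable g (volume.restrict (Ioo (0 : ℝ) 1)) :=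
  (Lp.memLp g).integrable (by norm_num)

theorem IsTest.continuous {φ : ℝ → ℝ} (h : IsTest φ) : Continuous φ := h.1.continuous

theorem IsTest.continuous_deriv {φ : ℝ → ℝ} (h : IsTest φ) : Continuous (deriv φ) :=
  h.1.continuous_deriv (by simp)

theorem IsTest.integrable_smul {φ : ℝ → ℝ} (h : IsTest φ) (g : L2) :
    Integrable (fun x => φ x • g x) (volume.restrict (Ioo (0 : ℝ) 1)) := by
  obtain ⟨C, hC⟩ := h.2.1.exists_bound_of_continuous h.continuous
  exact (integrable_L2 g).bdd_smul C h.continuous.aestronglyMeasurable (ae_of_all _ hC)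

/-- The pairs of a continuous function on `[0, 1]` and its weak derivative in `L²(0, 1)`. -/
def H1.graph : Submodule ℂ (C(Icc (0 : ℝ) 1, ℂ) × L2) where
  carrier := {p | HasWeakDeriv (ext p.1) p.2}
  zero_mem' := by
    intro φ hφ
    have h1 : ∀ x, ext (0 : C(Icc (0 : ℝ) 1, ℂ)) x = 0 := fun x => rfl
    have h2 : ∫ x in Ioo (0 : ℝ) 1, φ x • (0 : L2) x = ∫ x in Ioo (0 : ℝ) 1, (0 : ℂ) := by
      apply integral_congr_ae
      filter_upwards [Lp.coeFn_zero ℂ 2 (volume.restrict (Ioo (0 : ℝ) 1))] with x hx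
      rw [hx]; simp
    simp only [Prod.fst_zero, Prod.snd_zero, h1, h2]
    simp
  add_mem' := by
    rintro ⟨f, g⟩ ⟨f', g'⟩ h h' φ hφ
    have h1 : ∀ x, ext (f + f') x = ext f x + ext f' x := fun x => rfl
    have h2 : ∫ x in Ioo (0 : ℝ) 1, φ x • (g + g' : L2) x
        = ∫ x in Ioo (0 : ℝ) 1, (φ x • g x + φ x • g' x) := by
      apply integral_congr_ae
      filter_upwards [Lp.coeFn_add g g'] with x hx
      rw [hx]; simp
    have e1 := h φ hφ
    have e2 := h' φ hφ
    simp only at e1 e2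
    simp only [Prod.mk_add_mk, h1, h2, smul_add]
    have i1 : Integrable (fun x => deriv φ x • ext f x) (volume.restrict (Ioo (0 : ℝ) 1)) :=
      integrableOn_of_continuous (hφ.continuous_deriv.smul (continuous_ext f))
    have i2 : Integrable (fun x => deriv φ x • ext f' x) (volume.restrict (Ioo (0 : ℝ) 1)) :=
      integrableOn_of_continuous (hφ.continuous_deriv.smul (continuous_ext f'))
    rw [integral_add i1 i2, integral_add (hφ.integrable_smul g) (hφ.integrable_smul g'), e1, e2,
      neg_add]
  smul_mem' := by
    rintro c ⟨f, g⟩ h φ hφ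
    have h1 : ∀ x, deriv φ x • ext (c • f) x = c • (deriv φ x • ext f x) := fun x =>
      smul_comm (deriv φ x) c (ext f x)
    have h2 : ∫ x in Ioo (0 : ℝ) 1, φ x • (c • g : L2) x
        = ∫ x in Ioo (0 : ℝ) 1, c • (φ x • g x) := by
      apply integral_congr_ae
      filter_upwards [Lp.coeFn_smul c g] with x hx
      rw [hx, Pi.smul_apply, smul_comm]
    have e1 := h φ hφ
    simp only at e1
    simp only [Prod.smul_mk, h1, h2]
    rw [integral_smul, integral_smul, e1, smul_neg]

/-- The Sobolev space `H¹(0, 1)`. An element is recorded by its continuous representative on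
`[0, 1]` (which exists and is unique in dimension one, and gives the point values of the
function) together with its weak derivative in `L²(0, 1)`. -/
def H1 : Type := H1.graph

instance : AddCommGroup H1 := Submodule.addCommGroup H1.graph

instance : Module ℂ H1 := Submodule.module H1.graph

namespace H1

/-- The value at a point of `[0, 1]` of (the continuous representative of) an `H¹` function. -/
def eval (x : Icc (0 : ℝ) 1) : H1 →ₗ[ℂ] ℂ where
  toFun f := f.1.1 x
  map_add' _ _ := rfl
  map_smul' _ _ := rfl

/-- The weak derivative `H¹(0, 1) → L²(0, 1)`. -/
def wderiv : H1 →ₗ[ℂ] L2 := LinearMap.snd ℂ C(Icc (0 : ℝ) 1, ℂ) L2 ∘ₗ H1.graph.subtype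

/-- The inclusion `H¹(0, 1) → L²(0, 1)`. -/
def toL2 : H1 →ₗ[ℂ] L2 := 
  contToL2 ∘ₗ LinearMap.fst ℂ C(Icc (0 : ℝ) 1, ℂ) L2 ∘ₗ H1.graph.subtype

end H1

/-- The weak derivative is unique. -/
theorem eq_zero_of_hasWeakDeriv_zero {g : L2} (h : HasWeakDeriv (ext 0) g) : g = 0 := by
  have key : ∀ᵐ x ∂(volume : Measure ℝ), x ∈ Ioo (0 : ℝ) 1 → g x = 0 := by
    apply isOpen_Ioo.ae_eq_zero_of_integral_contDiff_smul_eq_zero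
    · exact IntegrableOn.locallyIntegrableOn (integrable_L2 g)
    · intro φ h1 h2 h3
      have e := h φ ⟨h1, h2, h3⟩
      have e0 : ∀ x, ext (0 : C(Icc (0 : ℝ) 1, ℂ)) x = 0 := fun x => rfl
      simp only [e0, smul_zero, integral_zero] at e
      have e' := neg_eq_zero.mp e.symm
      rw [← e']
      symm
      apply setIntegral_eq_integral_of_forall_compl_eq_zero
      intro x hx
      rw [image_eq_zero_of_notMem_tsupport (fun hx' => hx (h3 hx')), zero_smul]
  rw [Lp.eq_zero_iff_ae_eq_zero]
  rw [← ae_restrict_iff' measurableSet_Ioo] at key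
  exact key

theorem H1.toL2_injective : Function.Injective H1.toL2 := by
  rw [injective_iff_map_eq_zero]
  rintro ⟨⟨f, g⟩, h⟩ h0
  have hf : f = 0 := contToL2_injective (h0.trans (map_zero _).symm)
  subst hf
  have hg : g = 0 := eq_zero_of_hasWeakDeriv_zero h
  subst hg
  rfl

/-- A mean-zero test function is the derivative of a test function. -/
theorem IsTest.primitive {ψ : ℝ → ℝ} (h : IsTest ψ) (h0 : ∫ x in (0 : ℝ)..1, ψ x = 0) :
    IsTest (fun x => ∫ t in (0 : ℝ)..x, ψ t) ∧
      deriv (fun x => ∫ t in (0 : ℝ)..x, ψ t) = ψ := by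
  have hd : deriv (fun x => ∫ t in (0 : ℝ)..x, ψ t) = ψ := by
    ext x; exact h.continuous.deriv_integral ψ 0 x
  obtain ⟨α, β, hα, hβ, hs⟩ : ∃ α β : ℝ, 0 < α ∧ β < 1 ∧ tsupport ψ ⊆ Icc α β := by
    rcases (tsupport ψ).eq_empty_or_nonempty with he | hne
    · exact ⟨1 / 2, 1 / 2, by norm_num, by norm_num, by simp [he]⟩
    · obtain ⟨α, hα⟩ := h.2.1.exists_isLeast hne
      obtain ⟨β, hβ⟩ := h.2.1.exists_isGreatest hne
      exact ⟨α, β, (h.2.2 hα.1).1, (h.2.2 hβ.1).2, fun x hx => ⟨hα.2 hx, hβ.2 hx⟩⟩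
  have hz : ∀ t, t ∉ Icc α β → ψ t = 0 := fun t ht =>
    image_eq_zero_of_notMem_tsupport fun ht' => ht (hs ht')
  have hsub : tsupport (fun x => ∫ t in (0 : ℝ)..x, ψ t) ⊆ Icc α β := by
    refine closure_minimal (fun x hx => ?_) isClosed_Icc
    by_contra hn
    apply hx
    rw [mem_Icc, not_and_or, not_le, not_le] at hn
    rcases hn with hn | hn
    · change ∫ t in (0 : ℝ)..x, ψ t = 0
      rw [intervalIntegral.integral_congr (g := fun _ => (0 : ℝ))]
      · simp
      · intro t ht
        apply hz
        rintro ⟨h1, -⟩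
        have := ht.2
        rcases le_max_iff.mp this with h2 | h2 <;> linarith
    · have hadd := intervalIntegral.integral_add_adjacent_intervals
        (h.continuous.intervalIntegrable (μ := volume) 0 x)
        (h.continuous.intervalIntegrable (μ := volume) x 1)
      have : ∫ t in x..1, ψ t = 0 := by
        rw [intervalIntegral.integral_congr (g := fun _ => (0 : ℝ))]
        · simp
        · intro t ht
          apply hz
          rintro ⟨-, h1⟩
          rcases min_le_iff.mp ht.1 with h2 | h2 <;> linarith
      simp only
      linarith
  refine ⟨⟨?_, ?_, ?_⟩, hd⟩
  · rw [contDiff_infty_iff_deriv]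
    refine ⟨fun x => ?_, by rw [hd]; exact h.1⟩
    exact (intervalIntegral.integral_hasDerivAt_right (h.continuous.intervalIntegrable _ _)
      (h.continuous.stronglyMeasurableAtFilter _ _) h.continuous.continuousAt).differentiableAt
  · exact HasCompactSupport.of_support_subset_isCompact isCompact_Icc
      (subset_closure.trans hsub)
  · exact hsub.trans fun x hx => ⟨hα.trans_le hx.1, hx.2.trans_lt hβ⟩

theorem exists_isTest_integral_one : ∃ ρ : ℝ → ℝ, IsTest ρ ∧ ∫ x in (0 : ℝ)..1, ρ x = 1 := by
  let B : ContDiffBump (1 / 2 : ℝ) := ⟨1 / 8, 1 / 4, by norm_num, by norm_num⟩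
  have hsub : tsupport (B.normed volume) ⊆ Ioo 0 1 := by
    rw [B.tsupport_normed_eq, Real.closedBall_eq_Icc]
    intro x hx
    have h1 : B.rOut = 1 / 4 := rfl
    rw [h1] at hx
    constructor <;> linarith [hx.1, hx.2]
  refine ⟨B.normed volume, ⟨B.contDiff_normed, B.hasCompactSupport_normed, hsub⟩, ?_⟩
  rw [intervalIntegral.integral_of_le zero_le_one,
    setIntegral_eq_integral_of_forall_compl_eq_zero, B.integral_normed]
  intro x hx
  exact image_eq_zero_of_notMem_tsupport fun hx' => hx (Ioo_subset_Ioc_self (hsub hx'))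

/-- An `H¹` function with zero weak derivative is constant. -/
theorem H1.eq_const_of_wderiv_eq_zero (f : H1) (h : H1.wderiv f = 0) :
    ∃ c : ℂ, ∀ x, f.1.1 x = c := by
  obtain ⟨ρ, hρ, hρ1⟩ := exists_isTest_integral_one
  obtain ⟨⟨f, g⟩, hf⟩ := f
  have hg : g = 0 := h
  subst hg
  have hf0 : ∀ φ, IsTest φ → ∫ x in Ioo (0 : ℝ) 1, deriv φ x • ext f x = 0 := by
    intro φ hφ
    have e := hf φ hφ
    simp only at e
    rw [e, neg_eq_zero]
    rw [← integral_zero ℝ ℂ (μ := volume.restrict (Ioo (0 : ℝ) 1))]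
    apply integral_congr_ae
    filter_upwards [Lp.coeFn_zero ℂ 2 (volume.restrict (Ioo (0 : ℝ) 1))] with x hx
    rw [hx]; simp
  set c : ℂ := ∫ x in Ioo (0 : ℝ) 1, ρ x • ext f x with hc
  refine ⟨c, fun x => ?_⟩
  have hIoo : ∀ φ : ℝ → ℝ, ∫ x in (0 : ℝ)..1, φ x = ∫ x in Ioo (0 : ℝ) 1, φ x := fun φ => by
    rw [intervalIntegral.integral_of_le zero_le_one, integral_Ioc_eq_integral_Ioo]
  have key : ∀ᵐ x ∂(volume : Measure ℝ), x ∈ Ioo (0 : ℝ) 1 → ext f x - c = 0 := by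
    apply isOpen_Ioo.ae_eq_zero_of_integral_contDiff_smul_eq_zero
    · exact IntegrableOn.locallyIntegrableOn
        (integrableOn_of_continuous ((continuous_ext f).sub continuous_const))
    · intro ψ h1 h2 h3
      have hψ : IsTest ψ := ⟨h1, h2, h3⟩
      set m : ℝ := ∫ x in (0 : ℝ)..1, ψ x with hm
      have hχ : IsTest (fun x => ψ x - m * ρ x) := by
        refine ⟨h1.sub (contDiff_const.mul hρ.1), h2.sub hρ.2.1.mul_left, ?_⟩
        refine (tsupport_sub ψ (fun x => m * ρ x)).trans (union_subset h3 ?_)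
        exact (tsupport_mul_subset_right (f := fun _ => m) (g := ρ)).trans hρ.2.2
      have hχ0 : ∫ x in (0 : ℝ)..1, (ψ x - m * ρ x) = 0 := by
        have hi : IntervalIntegrable (fun x => m * ρ x) volume 0 1 :=
          (continuous_const.mul hρ.continuous).intervalIntegrable _ _
        rw [intervalIntegral.integral_sub (hψ.continuous.intervalIntegrable _ _) hi,
          intervalIntegral.integral_const_mul, hρ1]
        simp [hm]
      obtain ⟨hP, hd⟩ := hχ.primitive hχ0
      have e := hf0 _ hP
      rw [hd] at e
      have i1 : Integrable (fun x => ψ x • ext f x) (volume.restrict (Ioo (0 : ℝ) 1)) :=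
        integrableOn_of_continuous (hψ.continuous.smul (continuous_ext f))
      have i2 : Integrable (fun x => ρ x • ext f x) (volume.restrict (Ioo (0 : ℝ) 1)) :=
        integrableOn_of_continuous (hρ.continuous.smul (continuous_ext f))
      have e2 : ∫ x in Ioo (0 : ℝ) 1, ψ x • ext f x = m • c := by
        have : ∀ x, (ψ x - m * ρ x) • ext f x = ψ x • ext f x - m • (ρ x • ext f x) := by
          intro x; rw [sub_smul, mul_smul]
        simp only [this] at e
        have i3 : Integrable (fun x => m • (ρ x • ext f x)) (volume.restrict (Ioo (0 : ℝ) 1)) :=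
          i2.smul m
        rw [integral_sub i1 i3, integral_smul] at e
        exact sub_eq_zero.mp e
      rw [← setIntegral_eq_integral_of_forall_compl_eq_zero (s := Ioo (0 : ℝ) 1)]
      · have : ∀ x, ψ x • (ext f x - c) = ψ x • ext f x - ψ x • c := fun x => smul_sub _ _ _
        simp only [this]
        have i4 : Integrable (fun x => ψ x • c) (volume.restrict (Ioo (0 : ℝ) 1)) :=
          integrableOn_of_continuous (hψ.continuous.smul continuous_const)
        rw [integral_sub i1 i4, e2, integral_smul_const, hm, hIoo, sub_self]
      · intro x hx
        rw [image_eq_zero_of_notMem_tsupport (fun hx' => hx (h3 hx')), zero_smul]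
  rw [← ae_restrict_iff' measurableSet_Ioo] at key
  have h2 : ext f =ᵐ[volume.restrict (Icc (0 : ℝ) 1)] fun _ => c := by
    rw [← restrict_Ioo_eq_restrict_Icc]
    filter_upwards [key] with x hx
    exact sub_eq_zero.mp hx
  have h3 := Measure.eqOn_Icc_of_ae_eq volume zero_ne_one h2
    (continuous_ext f).continuousOn continuousOn_const
  have := h3 x.2
  rwa [ext_of_mem f x.2] at this

/-- The space `H¹_L(0, 1)` of the `H¹` functions which vanish at `0`. -/
def H1L : Submodule ℂ H1 := LinearMap.ker (H1.eval 0)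

/-- The space `H²(0, 1)` of the `H¹` functions whose derivative is in `H¹`. -/
def H2 : Submodule ℂ H1 := Submodule.comap H1.wderiv (LinearMap.range H1.toL2)

/-- The derivative `H²(0, 1) → H¹(0, 1)`. -/
def H2.dx : H2 →ₗ[ℂ] H1 where
  toFun u := u.2.choose
  map_add' u w := H1.toL2_injective <| by
    rw [map_add, u.2.choose_spec, w.2.choose_spec, (u + w).2.choose_spec, ← map_add]; rfl
  map_smul' c u := H1.toL2_injective <| by
    rw [map_smul, u.2.choose_spec, (c • u).2.choose_spec, RingHom.id_apply, ← map_smul]; rfl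

theorem H2.toL2_dx (u : H2) : H1.toL2 (H2.dx u) = H1.wderiv u.1 := u.2.choose_spec

theorem H1.eq_zero_of_wderiv_eq_zero (f : H1) (h0 : f ∈ H1L) (h : H1.wderiv f = 0) : f = 0 := by
  obtain ⟨c, hc⟩ := f.eq_const_of_wderiv_eq_zero h
  have hc0 : c = 0 := (hc 0).symm.trans h0
  apply Subtype.ext
  refine Prod.ext ?_ h
  ext x
  rw [hc x, hc0]
  rfl

/-- The primitive vanishing at `0` of an `L²` function, as a continuous function. -/
def primitive (g : L2) : C(Icc (0 : ℝ) 1, ℂ) where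
  toFun x := ∫ t in Ioo (0 : ℝ) x, g t
  continuous_toFun := by
    have h1 : IntegrableOn (indicator (Ioo (0 : ℝ) 1) g) (uIcc (0 : ℝ) 1) :=
      (IntegrableOn.integrable_indicator (integrable_L2 g) measurableSet_Ioo).integrableOn
    have h2 := intervalIntegral.continuousOn_primitive_interval h1
    rw [uIcc_of_le zero_le_one] at h2
    refine (continuousOn_iff_continuous_domRestrict.mp h2).congr fun x => ?_
    rw [Set.domRestrict_apply, intervalIntegral.integral_of_le x.2.1, integral_Ioc_eq_integral_Ioo]
    refine setIntegral_congr_fun measurableSet_Ioo fun t ht => ?_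
    have h3 : t ∈ Ioo (0 : ℝ) 1 := ⟨ht.1, ht.2.trans_le x.2.2⟩
    exact indicator_of_mem h3 _

/-- The primitive of an `L²` function is in `H¹`. -/
theorem hasWeakDeriv_primitive (g : L2) : HasWeakDeriv (ext (primitive g)) g := by
  intro φ hφ
  set μ : Measure ℝ := volume.restrict (Ioo (0 : ℝ) 1) with hμ
  have hint : Integrable (fun q : ℝ × ℝ =>
      indicator {q : ℝ × ℝ | q.2 < q.1} (fun q => deriv φ q.1 • g q.2) q) (μ.prod μ) := by
    refine Integrable.indicator ?_ (measurableSet_lt measurable_snd measurable_fst)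
    exact (integrableOn_of_continuous hφ.continuous_deriv).smul_prod (integrable_L2 g)
  have hswap := integral_integral_swap (f := fun x t =>
      indicator {q : ℝ × ℝ | q.2 < q.1} (fun q => deriv φ q.1 • g q.2) (x, t)) hint
  have hl : ∀ x ∈ Ioo (0 : ℝ) 1, ∫ t, indicator {q : ℝ × ℝ | q.2 < q.1}
      (fun q => deriv φ q.1 • g q.2) (x, t) ∂μ = deriv φ x • ext (primitive g) x := by
    intro x hx
    rw [ext_of_mem _ (Ioo_subset_Icc_self hx)]
    change _ = deriv φ x • ∫ t in Ioo (0 : ℝ) x, g t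
    have e1 : ∀ t, indicator {q : ℝ × ℝ | q.2 < q.1} (fun q => deriv φ q.1 • g q.2) (x, t)
        = indicator (Iio x) (fun t => deriv φ x • g t) t := fun t => rfl
    simp only [e1]
    rw [integral_indicator measurableSet_Iio, hμ, Measure.restrict_restrict measurableSet_Iio,
      integral_smul]
    congr 3
    ext t
    exact ⟨fun h => ⟨h.2.1, h.1⟩, fun h => ⟨h.2, h.1, h.2.trans hx.2⟩⟩
  have hr : ∀ t ∈ Ioo (0 : ℝ) 1, ∫ x, indicator {q : ℝ × ℝ | q.2 < q.1}
      (fun q => deriv φ q.1 • g q.2) (x, t) ∂μ = - (φ t • g t) := by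
    intro t ht
    have e1 : ∀ x, indicator {q : ℝ × ℝ | q.2 < q.1} (fun q => deriv φ q.1 • g q.2) (x, t)
        = indicator (Ioi t) (fun x => deriv φ x • g t) x := fun t => rfl
    simp only [e1]
    rw [integral_indicator measurableSet_Ioi, hμ, Measure.restrict_restrict measurableSet_Ioi,
      integral_smul_const]
    have e2 : Ioi t ∩ Ioo 0 1 = Ioo t 1 := by
      ext x
      exact ⟨fun h => ⟨h.1, h.2.2⟩, fun h => ⟨h.1, ht.1.trans h.1, h.2⟩⟩
    rw [e2, ← integral_Ioc_eq_integral_Ioo, ← intervalIntegral.integral_of_le ht.2.le,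
      intervalIntegral.integral_deriv_eq_sub
        (fun x _ => (hφ.1.differentiable (by simp)).differentiableAt)
        (hφ.continuous_deriv.intervalIntegrable _ _)]
    have e3 : φ 1 = 0 := image_eq_zero_of_notMem_tsupport fun h => lt_irrefl _ (hφ.2.2 h).2
    rw [e3, zero_sub, neg_smul]
  rw [← setIntegral_congr_fun measurableSet_Ioo hl, hswap,
    setIntegral_congr_fun measurableSet_Ioo hr, integral_neg]

/-- An element of `H¹_L` is determined by its derivative, which is an arbitrary `L²` function. -/
theorem H1L.exists_wderiv_eq (g : L2) : ∃ f : H1L, H1.wderiv f = g := by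
  refine ⟨⟨(⟨(primitive g, g), hasWeakDeriv_primitive g⟩ : H1.graph), ?_⟩, rfl⟩
  change ∫ t in Ioo (0 : ℝ) 0, g t = 0
  simp

/-! ### The energy space -/

/-- The constants of the beam model, all strictly positive. -/
structure Params where
  /-- the squared wave speed in the equation for the rotation -/
  a : ℝ
  /-- the coupling constant -/
  b : ℝ
  /-- the coefficient of the boundary force -/
  k₁ : ℝ
  /-- the feedback gain in the force control -/
  k₂ : ℝ
  /-- the coefficient of the boundary moment -/
  k₃ : ℝ
  /-- the feedback gain in the moment control -/
  k₄ : ℝ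
  a_pos : 0 < a
  b_pos : 0 < b
  k₁_pos : 0 < k₁
  k₂_pos : 0 < k₂
  k₃_pos : 0 < k₃
  k₄_pos : 0 < k₄

/-- The energy space `H¹_L × L² × H¹_L × L² × ℂ × ℂ`. Its norm depends on the constants. -/
@[ext]
structure EnergySpace (p : Params) where
  /-- the displacement -/
  u : H1L
  /-- the velocity of the displacement -/
  v : L2
  /-- the rotation -/
  y : H1L
  /-- the velocity of the rotation -/
  z : L2
  /-- the velocity of the displacement at `x = 1` -/
  η : ℂ
  /-- the velocity of the rotation at `x = 1` -/
  γ : ℂ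

namespace EnergySpace

variable {p : Params}

/-- The energy space as a product. -/
def equivProd (p : Params) : EnergySpace p ≃ H1L × L2 × H1L × L2 × ℂ × ℂ where
  toFun U := (U.u, U.v, U.y, U.z, U.η, U.γ)
  invFun P := ⟨P.1, P.2.1, P.2.2.1, P.2.2.2.1, P.2.2.2.2.1, P.2.2.2.2.2⟩
  left_inv _ := rfl
  right_inv _ := rfl

/-- The componentwise vector space operations. -/
instance : AddCommGroup (EnergySpace p) := (equivProd p).addCommGroup

instance : SMul ℂ (EnergySpace p) :=
  ⟨fun c U => ⟨c • U.u, c • U.v, c • U.y, c • U.z, c • U.η, c • U.γ⟩⟩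

instance : Module ℂ (EnergySpace p) := {
  smul_add := fun c U V => by ext1 <;> exact smul_add c _ _
  add_smul := fun c d U => by ext1 <;> exact add_smul c d _
  mul_smul := fun c d U => by ext1 <;> exact mul_smul c d _
  one_smul := fun U => by ext1 <;> exact one_smul ℂ _
  smul_zero := fun c => by ext1 <;> exact smul_zero c
  zero_smul := fun U => by ext1 <;> exact zero_smul ℂ _ }

@[simp] theorem add_u (U V : EnergySpace p) : (U + V).u = U.u + V.u := rfl
@[simp] theorem add_v (U V : EnergySpace p) : (U + V).v = U.v + V.v := rfl
@[simp] theorem add_y (U V : EnergySpace p) : (U + V).y = U.y + V.y := rfl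
@[simp] theorem add_z (U V : EnergySpace p) : (U + V).z = U.z + V.z := rfl
@[simp] theorem add_η (U V : EnergySpace p) : (U + V).η = U.η + V.η := rfl
@[simp] theorem add_γ (U V : EnergySpace p) : (U + V).γ = U.γ + V.γ := rfl
@[simp] theorem smul_u (c : ℂ) (U : EnergySpace p) : (c • U).u = c • U.u := rfl
@[simp] theorem smul_v (c : ℂ) (U : EnergySpace p) : (c • U).v = c • U.v := rfl
@[simp] theorem smul_y (c : ℂ) (U : EnergySpace p) : (c • U).y = c • U.y := rfl
@[simp] theorem smul_z (c : ℂ) (U : EnergySpace p) : (c • U).z = c • U.z := rfl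
@[simp] theorem smul_η (c : ℂ) (U : EnergySpace p) : (c • U).η = c • U.η := rfl
@[simp] theorem smul_γ (c : ℂ) (U : EnergySpace p) : (c • U).γ = c • U.γ := rfl

/-- The shear `u_x + y` in `L²(0, 1)`. -/
def shear (U : EnergySpace p) : L2 := H1.wderiv U.u + H1.toL2 U.y

theorem shear_add (U V : EnergySpace p) : (U + V).shear = U.shear + V.shear := by
  simp only [shear, add_u, add_y, Submodule.coe_add, map_add]; abel

theorem shear_smul (c : ℂ) (U : EnergySpace p) : (c • U).shear = c • U.shear := by
  simp only [shear, smul_u, smul_y, Submodule.coe_smul, map_smul, smul_add]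

/-- The energy inner product
`∫ (v v̄₁ + b⁻¹ z z̄₁ + a b⁻¹ y_x ȳ₁ₓ + (u_x + y) conj (u₁ₓ + y₁)) + k₁⁻¹ η η̄₁ + k₃⁻¹ γ γ̄₁`
of `U` and `U₁`. As everywhere in Mathlib the conjugate-linear argument `U₁` comes first. -/
def energyInner (U₁ U : EnergySpace p) : ℂ :=
  inner ℂ U₁.v U.v + (p.b : ℂ)⁻¹ * inner ℂ U₁.z U.z
    + (p.a : ℂ) * (p.b : ℂ)⁻¹ * inner ℂ (H1.wderiv U₁.y) (H1.wderiv U.y)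
    + inner ℂ U₁.shear U.shear
    + (p.k₁ : ℂ)⁻¹ * (U.η * conj U₁.η) + (p.k₃ : ℂ)⁻¹ * (U.γ * conj U₁.γ)

theorem energyInner_self (U : EnergySpace p) : energyInner U U =
    ((‖U.v‖ ^ 2 + p.b⁻¹ * ‖U.z‖ ^ 2 + p.a * p.b⁻¹ * ‖H1.wderiv U.y‖ ^ 2 + ‖U.shear‖ ^ 2
      + p.k₁⁻¹ * ‖U.η‖ ^ 2 + p.k₃⁻¹ * ‖U.γ‖ ^ 2 : ℝ) : ℂ) := by
  simp only [energyInner, inner_self_eq_norm_sq_to_K, Complex.mul_conj,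
    Complex.normSq_eq_norm_sq]
  push_cast
  rfl

theorem eq_zero_of_energyInner_self (U : EnergySpace p) (h : energyInner U U = 0) : U = 0 := by
  have ha := p.a_pos
  have hb := p.b_pos
  have h1 := p.k₁_pos
  have h3 := p.k₃_pos
  rw [energyInner_self, Complex.ofReal_eq_zero] at h
  have e1 : 0 ≤ ‖U.v‖ ^ 2 := by positivity
  have e2 : 0 ≤ p.b⁻¹ * ‖U.z‖ ^ 2 := by positivity
  have e3 : 0 ≤ p.a * p.b⁻¹ * ‖H1.wderiv U.y‖ ^ 2 := by positivity
  have e4 : 0 ≤ ‖U.shear‖ ^ 2 := by positivity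
  have e5 : 0 ≤ p.k₁⁻¹ * ‖U.η‖ ^ 2 := by positivity
  have e6 : 0 ≤ p.k₃⁻¹ * ‖U.γ‖ ^ 2 := by positivity
  have hv : ‖U.v‖ ^ 2 = 0 := by linarith
  have hz : p.b⁻¹ * ‖U.z‖ ^ 2 = 0 := by linarith
  have hy : p.a * p.b⁻¹ * ‖H1.wderiv U.y‖ ^ 2 = 0 := by linarith
  have hs : ‖U.shear‖ ^ 2 = 0 := by linarith
  have hη : p.k₁⁻¹ * ‖U.η‖ ^ 2 = 0 := by linarith
  have hγ : p.k₃⁻¹ * ‖U.γ‖ ^ 2 = 0 := by linarith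
  have hc1 : p.a * p.b⁻¹ ≠ 0 := by positivity
  simp only [mul_eq_zero_iff_left, inv_eq_zero, hb.ne', h1.ne', h3.ne', ne_eq, not_false_eq_true,
    hc1, pow_eq_zero_iff, OfNat.ofNat_ne_zero, norm_eq_zero]
    at hv hz hy hs hη hγ
  have hy0 : U.y = 0 := Subtype.ext (H1.eq_zero_of_wderiv_eq_zero _ U.y.2 hy)
  have hu : H1.wderiv U.u = 0 := by
    rw [shear, hy0, Submodule.coe_zero, map_zero, add_zero] at hs
    exact hs
  have hu0 : U.u = 0 := Subtype.ext (H1.eq_zero_of_wderiv_eq_zero _ U.u.2 hu)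
  exact EnergySpace.ext hu0 hv hy0 hz hη hγ

/-- The energy inner product turns the energy space into a pre-Hilbert space. -/
@[reducible]
def innerCore (p : Params) : InnerProductSpace.Core ℂ (EnergySpace p) where
  inner := energyInner
  conj_inner_symm U V := by
    simp only [energyInner, map_add, map_mul, map_inv₀, Complex.conj_ofReal, inner_conj_symm,
      Complex.conj_conj]
    ring
  re_inner_nonneg U := by
    have ha := p.a_pos
    have hb := p.b_pos
    have h1 := p.k₁_pos
    have h3 := p.k₃_pos
    rw [energyInner_self, RCLike.re_to_complex, Complex.ofReal_re]
    positivity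
  add_left U V W := by
    simp only [energyInner, add_v, add_z, add_y, add_η, add_γ, shear_add, Submodule.coe_add,
      map_add, inner_add_left]
    ring
  smul_left U V c := by
    simp only [energyInner, smul_v, smul_z, smul_y, smul_η, smul_γ, shear_smul,
      Submodule.coe_smul, map_smul, inner_smul_left, smul_eq_mul, map_mul]
    ring
  definite := eq_zero_of_energyInner_self

instance : NormedAddCommGroup (EnergySpace p) := (innerCore p).toNormedAddCommGroup

instance : InnerProductSpace ℂ (EnergySpace p) := InnerProductSpace.ofCore (innerCore p).toCore

theorem norm_sq_eq (U : EnergySpace p) : ‖U‖ ^ 2 =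
    ‖U.v‖ ^ 2 + p.b⁻¹ * ‖U.z‖ ^ 2 + p.a * p.b⁻¹ * ‖H1.wderiv U.y‖ ^ 2 + ‖U.shear‖ ^ 2
      + p.k₁⁻¹ * ‖U.η‖ ^ 2 + p.k₃⁻¹ * ‖U.γ‖ ^ 2 := by
  rw [norm_sq_eq_re_inner (𝕜 := ℂ) U]
  change RCLike.re (energyInner U U) = _
  rw [energyInner_self, RCLike.re_to_complex, Complex.ofReal_re]

/-- The coordinates in which the energy inner product is diagonal. -/
def coord (p : Params) : EnergySpace p →ₗ[ℂ] L2 × L2 × L2 × L2 × ℂ × ℂ where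
  toFun U := (U.v, U.z, H1.wderiv U.y, U.shear, U.η, U.γ)
  map_add' U V := by
    simp only [add_v, add_z, add_y, add_η, add_γ, shear_add, Submodule.coe_add, map_add,
      Prod.mk_add_mk]
  map_smul' c U := by
    simp only [smul_v, smul_z, smul_y, smul_η, smul_γ, shear_smul, Submodule.coe_smul, map_smul,
      Prod.smul_mk, RingHom.id_apply]

theorem coord_bijective (p : Params) : Function.Bijective (coord p) := by
  constructor
  · rw [injective_iff_map_eq_zero]
    intro U hU
    simp only [coord, LinearMap.coe_mk, AddHom.coe_mk, Prod.mk_eq_zero] at hU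
    obtain ⟨h1, h2, h3, h4, h5, h6⟩ := hU
    apply eq_zero_of_energyInner_self
    rw [energyInner_self, h1, h2, h3, h4, h5, h6]
    simp
  · rintro ⟨v, z, q, s, η, γ⟩
    obtain ⟨y, hy⟩ := H1L.exists_wderiv_eq q
    obtain ⟨u, hu⟩ := H1L.exists_wderiv_eq (s - H1.toL2 y)
    refine ⟨⟨u, v, y, z, η, γ⟩, ?_⟩
    simp only [coord, LinearMap.coe_mk, AddHom.coe_mk, shear, hy, hu, sub_add_cancel]

/-- The energy space is a Hilbert space. -/
instance : CompleteSpace (EnergySpace p) := by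
  have ha := p.a_pos
  have hb := p.b_pos
  have h1 := p.k₁_pos
  have h3 := p.k₃_pos
  have hto : ∀ U, ‖coord p U‖ ≤ √(1 + p.b + p.b / p.a + p.k₁ + p.k₃) * ‖U‖ := by
    intro U
    have e1 : 0 ≤ ‖U.v‖ ^ 2 := by positivity
    have e2 : 0 ≤ p.b⁻¹ * ‖U.z‖ ^ 2 := by positivity
    have e3 : 0 ≤ p.a * p.b⁻¹ * ‖H1.wderiv U.y‖ ^ 2 := by positivity
    have e4 : 0 ≤ ‖U.shear‖ ^ 2 := by positivity
    have e5 : 0 ≤ p.k₁⁻¹ * ‖U.η‖ ^ 2 := by positivity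
    have e6 : 0 ≤ p.k₃⁻¹ * ‖U.γ‖ ^ 2 := by positivity
    have e := norm_sq_eq U
    have hU : 0 ≤ ‖U‖ ^ 2 := by positivity
    have hd : 0 < p.b / p.a := by positivity
    set K := 1 + p.b + p.b / p.a + p.k₁ + p.k₃ with hK
    have key : ∀ (c w : ℝ), 0 ≤ c → 0 < w → w ≤ K → w⁻¹ * c ^ 2 ≤ ‖U‖ ^ 2 →
        c ≤ √K * ‖U‖ := by
      intro c w hc hw hwK hle
      have hK0 : 0 ≤ K := hw.le.trans hwK
      rw [← abs_of_nonneg hc, ← Real.sqrt_sq_eq_abs, ← Real.sqrt_sq (norm_nonneg U),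
        ← Real.sqrt_mul hK0]
      apply Real.sqrt_le_sqrt
      rw [inv_mul_le_iff₀ hw] at hle
      exact hle.trans (mul_le_mul_of_nonneg_right hwK hU)
    simp only [coord, LinearMap.coe_mk, AddHom.coe_mk, Prod.norm_mk, max_le_iff]
    refine ⟨key _ 1 (norm_nonneg _) one_pos ?_ ?_, key _ p.b (norm_nonneg _) hb ?_ ?_,
      key _ (p.b / p.a) (norm_nonneg _) hd ?_ ?_, key _ 1 (norm_nonneg _) one_pos ?_ ?_,
      key _ p.k₁ (norm_nonneg _) h1 ?_ ?_, key _ p.k₃ (norm_nonneg _) h3 ?_ ?_⟩ <;>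
      first
      | linarith
      | (rw [inv_div, div_eq_mul_inv]; linarith)
  have hinv : ∀ U, ‖U‖ ≤ √(2 + p.b⁻¹ + p.a * p.b⁻¹ + p.k₁⁻¹ + p.k₃⁻¹) * ‖coord p U‖ := by
    intro U
    have hN : ‖coord p U‖ ≤ ‖coord p U‖ := le_rfl
    nth_rewrite 1 [coord] at hN
    simp only [LinearMap.coe_mk, AddHom.coe_mk, Prod.norm_mk, max_le_iff] at hN
    obtain ⟨n1, n2, n3, n4, n5, n6⟩ := hN
    rw [← Real.sqrt_sq (norm_nonneg (coord p U)), ← Real.sqrt_mul (by positivity)]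
    apply Real.le_sqrt_of_sq_le
    rw [norm_sq_eq]
    have m1 := pow_le_pow_left₀ (norm_nonneg _) n1 2
    have m2 := mul_le_mul_of_nonneg_left (pow_le_pow_left₀ (norm_nonneg _) n2 2)
      (inv_nonneg.mpr hb.le)
    have m3 := mul_le_mul_of_nonneg_left (pow_le_pow_left₀ (norm_nonneg _) n3 2)
      (mul_nonneg ha.le (inv_nonneg.mpr hb.le))
    have m4 := pow_le_pow_left₀ (norm_nonneg _) n4 2
    have m5 := mul_le_mul_of_nonneg_left (pow_le_pow_left₀ (norm_nonneg _) n5 2)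
      (inv_nonneg.mpr h1.le)
    have m6 := mul_le_mul_of_nonneg_left (pow_le_pow_left₀ (norm_nonneg _) n6 2)
      (inv_nonneg.mpr h3.le)
    nlinarith
  let e := LinearEquiv.ofBijective (coord p) (coord_bijective p)
  let e' := e.toContinuousLinearEquivOfBounds (√(1 + p.b + p.b / p.a + p.k₁ + p.k₃))
    (√(2 + p.b⁻¹ + p.a * p.b⁻¹ + p.k₁⁻¹ + p.k₃⁻¹)) hto (fun x => by
      have := hinv (e.symm x)
      have h : coord p (e.symm x) = x := e.apply_symm_apply x
      rwa [h] at this)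
  exact (completeSpace_congr (e := e'.toEquiv) e'.isUniformEmbedding).mpr inferInstance

end EnergySpace

/-! ### The operator -/

open EnergySpace in
/-- The domain of the operator: `u, y ∈ H²`, `v, z ∈ H¹_L`, `η = v(1)`, `γ = z(1)`. -/
def domain (p : Params) : Submodule ℂ (EnergySpace p) where
  carrier := {U | (U.u : H1) ∈ H2 ∧ (U.y : H1) ∈ H2 ∧
    (∃ v ∈ H1L, H1.toL2 v = U.v ∧ U.η = H1.eval 1 v) ∧
    (∃ z ∈ H1L, H1.toL2 z = U.z ∧ U.γ = H1.eval 1 z)}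
  zero_mem' := ⟨zero_mem _, zero_mem _, ⟨0, zero_mem _, map_zero _, (map_zero _).symm⟩,
    ⟨0, zero_mem _, map_zero _, (map_zero _).symm⟩⟩
  add_mem' := by
    rintro U V ⟨hu, hy, ⟨v, hv, hv1, hv2⟩, ⟨z, hz, hz1, hz2⟩⟩
      ⟨hu', hy', ⟨v', hv', hv1', hv2'⟩, ⟨z', hz', hz1', hz2'⟩⟩
    refine ⟨add_mem hu hu', add_mem hy hy', ⟨v + v', add_mem hv hv', ?_, ?_⟩,
      ⟨z + z', add_mem hz hz', ?_, ?_⟩⟩ <;> simp [*]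
  smul_mem' := by
    rintro c U ⟨hu, hy, ⟨v, hv, hv1, hv2⟩, ⟨z, hz, hz1, hz2⟩⟩
    refine ⟨H2.smul_mem c hu, H2.smul_mem c hy, ⟨c • v, H1L.smul_mem c hv, ?_, ?_⟩,
      ⟨c • z, H1L.smul_mem c hz, ?_, ?_⟩⟩ <;> simp [*]

namespace domain

variable {p : Params}

/-- The component `u` of an element of the domain, in `H²`. -/
def u : domain p →ₗ[ℂ] H2 where
  toFun U := ⟨U.1.u, U.2.1⟩
  map_add' _ _ := rfl
  map_smul' _ _ := rfl

/-- The component `y` of an element of the domain, in `H²`. -/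
def y : domain p →ₗ[ℂ] H2 where
  toFun U := ⟨U.1.y, U.2.2.1⟩
  map_add' _ _ := rfl
  map_smul' _ _ := rfl

theorem v_exists (U : domain p) : ∃ v : H1L, H1.toL2 v = U.1.v := by
  obtain ⟨v, hv, h, -⟩ := U.2.2.2.1
  exact ⟨⟨v, hv⟩, h⟩

theorem z_exists (U : domain p) : ∃ z : H1L, H1.toL2 z = U.1.z := by
  obtain ⟨z, hz, h, -⟩ := U.2.2.2.2
  exact ⟨⟨z, hz⟩, h⟩

/-- The component `v` of an element of the domain, in `H¹_L`. -/
def v : domain p →ₗ[ℂ] H1L where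
  toFun U := (v_exists U).choose
  map_add' U V := Subtype.ext <| H1.toL2_injective <| by
    refine (v_exists (U + V)).choose_spec.trans ?_
    rw [Submodule.coe_add, Submodule.coe_add, map_add, (v_exists U).choose_spec, (v_exists V).choose_spec]
    rfl
  map_smul' c U := Subtype.ext <| H1.toL2_injective <| by
    refine (v_exists (c • U)).choose_spec.trans ?_
    rw [RingHom.id_apply, Submodule.coe_smul, Submodule.coe_smul, map_smul, (v_exists U).choose_spec]
    rfl

/-- The component `z` of an element of the domain, in `H¹_L`. -/
def z : domain p →ₗ[ℂ] H1L where
  toFun U := (z_exists U).choose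
  map_add' U V := Subtype.ext <| H1.toL2_injective <| by
    refine (z_exists (U + V)).choose_spec.trans ?_
    rw [Submodule.coe_add, Submodule.coe_add, map_add, (z_exists U).choose_spec, (z_exists V).choose_spec]
    rfl
  map_smul' c U := Subtype.ext <| H1.toL2_injective <| by
    refine (z_exists (c • U)).choose_spec.trans ?_
    rw [RingHom.id_apply, Submodule.coe_smul, Submodule.coe_smul, map_smul, (z_exists U).choose_spec]
    rfl

theorem toL2_v (U : domain p) : H1.toL2 (v U) = U.1.v := (v_exists U).choose_spec

theorem toL2_z (U : domain p) : H1.toL2 (z U) = U.1.z := (z_exists U).choose_spec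

end domain

open EnergySpace in
/-- The unbounded operator of the beam with tip load,
`A U = (v, (u_x + y)_x, z, a y_xx - b (u_x + y),
  -k₁ (u_x(1) + y(1)) - k₂ η, -k₃ y_x(1) - k₄ γ)`. -/
def beamOperator (p : Params) : EnergySpace p →ₗ.[ℂ] EnergySpace p where
  domain := domain p
  toFun :=
    { toFun := fun U =>
        { u := domain.v U
          v := H1.wderiv (H2.dx (domain.u U) + (domain.y U : H1))
          y := domain.z U
          z := (p.a : ℂ) • H1.wderiv (H2.dx (domain.y U))
            - (p.b : ℂ) • H1.toL2 (H2.dx (domain.u U) + (domain.y U : H1))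
          η := -p.k₁ * (H1.eval 1 (H2.dx (domain.u U)) + H1.eval 1 (domain.y U)) - p.k₂ * U.1.η
          γ := -p.k₃ * H1.eval 1 (H2.dx (domain.y U)) - p.k₄ * U.1.γ }
      map_add' := fun U V => by
        ext1 <;> simp only [map_add, Submodule.coe_add, add_u, add_v, add_y, add_z, add_η, add_γ,
          smul_add] <;> first | rfl | ring | module
      map_smul' := fun c U => by
        ext1 <;> simp only [map_smul, Submodule.coe_smul, smul_u, smul_v, smul_y, smul_z, smul_η,
          smul_γ, RingHom.id_apply, smul_eq_mul, ← smul_add] <;>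
          first | rfl | (rw [smul_sub, smul_comm c, smul_comm c]) | ring }

/-! ### Solutions of abstract Cauchy problems -/

section Cauchy

variable {E : Type*} [NormedAddCommGroup E] [NormedSpace ℂ E] [CompleteSpace E]

/-- `U ∈ C⁰([0, ∞), E)` is a (mild) solution of `U' = A U`, `U(0) = U₀`: the problem holds in its
time-integrated form, where `∫₀ᵗ U` is in the domain of `A` for all `t ≥ 0`. Only the values of `U`
on `[0, ∞)` matter. -/
structure IsMildSolution (A : E →ₗ.[ℂ] E) (U₀ : E) (U : ℝ → E) : Prop where
  continuousOn : ContinuousOn U (Ici 0)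
  integral_eq : ∀ t : ℝ, 0 ≤ t →
    ∃ h : ∫ s in (0 : ℝ)..t, U s ∈ A.domain, U t = U₀ + A ⟨∫ s in (0 : ℝ)..t, U s, h⟩

/-- `U ∈ C⁰([0, ∞), D(A)) ∩ C¹([0, ∞), E)`, where `D(A)` carries the graph norm, is a (classical)
solution of `U' = A U` on `(0, ∞)`, `U(0) = U₀`. Only the values of `U` on `[0, ∞)` matter. -/
structure IsClassicalSolution (A : E →ₗ.[ℂ] E) (U₀ : E) (U : ℝ → E) : Prop where
  mem_domain : ∀ t ∈ Ici (0 : ℝ), U t ∈ A.domain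
  continuous_graph :
    Continuous fun t : Ici (0 : ℝ) => ((U t, A ⟨U t, mem_domain t t.2⟩) : E × E)
  contDiffOn : ContDiffOn ℝ 1 U (Ici 0)
  hasDerivAt : ∀ (t : ℝ) (ht : 0 < t), HasDerivAt U (A ⟨U t, mem_domain t ht.le⟩) t
  initial : U 0 = U₀

end Cauchy

end Timoshenko

end

/-! ### Evolution equations with a dissipative inverse

Let `B` be a linear operator with `⟪B x, x⟫ ≤ 0` for all `x`. If `B` is injective then its inverse `A`
is a densely defined maximal dissipative operator. -/

namespace Dissipative

open Filter Topology

/-! The operator `A` need not be dissipative for the given inner product: integration by parts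
produces `(a/b) y_x(1) conj z(1)`, while the tip load contributes `-y_x(1) conj z(1)`. Weighting `γ`
by `a / (b k₃)` instead of `1 / k₃` gives an equivalent Hilbert norm for which `Re ⟪A U, U⟫ =
-(k₂/k₁)|v(1)|² - (a k₄/(b k₃))|z(1)|²` (`beamOperator_dissipative`). Moreover `A` is onto, because
`A U = W` can be solved by successive integrations (`beamOperator_surjective`).

These two facts suffice (`wellPosed`). A surjective dissipative operator is injective, and its
inverse `B` is an everywhere defined dissipative operator, hence bounded with dense range. A mild
solution is then a continuous solution of `B (U t - U₀) = ∫₀ᵗ U`, an equation in which only a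
bounded operator occurs.

Uniqueness is an energy estimate for `w = ∫₀ᵗ U`, since `w = B w'`. For existence, `B` is replaced
by `B - ε`, which has a bounded inverse; the exponentials of these inverses are contractions and
converge as `ε → 0`, first on the range of `B`, then everywhere by density. Since `B = A⁻¹`, this is
the Yosida approximation of `A`. Finally, if `X` is the mild solution starting at `A U₀`, then `B X`
is the classical solution starting at `U₀`. -/

theorem nonpos_of_forall_add_mul_nonpos {c d : ℝ} (h : ∀ s : ℝ, 0 < s → c + s * d ≤ 0) : c ≤ 0 := by
  have h1 : Tendsto (fun s : ℝ => c + s * d) (𝓝[>] 0) (𝓝 (c + 0 * d)) :=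
    (Continuous.tendsto (by fun_prop) 0).mono_left nhdsWithin_le_nhds
  rw [zero_mul, add_zero] at h1
  exact le_of_tendsto h1 (eventually_nhdsWithin_of_forall h)

variable {F : Type*} [NormedAddCommGroup F] [InnerProductSpace ℝ F]

theorem inner_add_smul_self (B : F →ₗ[ℝ] F) (x y : F) (s : ℝ) :
    inner ℝ (B (x + s • y)) (x + s • y) =
      inner ℝ (B x) x + s * (inner ℝ (B x) y + inner ℝ (B y) x + s * inner ℝ (B y) y) := by
  simp only [map_add, map_smul, inner_add_left, inner_add_right, real_inner_smul_left,
    real_inner_smul_right]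
  ring

/-- Dissipativity at `x n + s • w`, in the limit and after division by `s`, reads `⟪y, w⟫ + s ⟪B w,
w⟫ ≤ 0`; letting `s → 0` removes the last term. As `w` is arbitrary, `y = 0`, which is the closed
graph property. -/
theorem inner_nonpos_of_tendsto {B : F →ₗ[ℝ] F} (hB : ∀ x, inner ℝ (B x) x ≤ 0)
    {x : ℕ → F} {y : F} (hx : Tendsto x atTop (𝓝 0)) (hy : Tendsto (fun n => B (x n)) atTop (𝓝 y))
    (w : F) : inner ℝ y w ≤ 0 := by
  refine nonpos_of_forall_add_mul_nonpos (d := inner ℝ (B w) w) fun s hs => ?_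
  have h1 : Tendsto (fun n => inner ℝ (B (x n + s • w)) (x n + s • w)) atTop
      (𝓝 (inner ℝ (y + s • B w) (0 + s • w))) := by
    refine Tendsto.inner ?_ (hx.add_const _)
    simp only [map_add, map_smul]
    exact hy.add_const _
  have h2 := le_of_tendsto h1 (Eventually.of_forall fun n => hB _)
  simp only [zero_add, inner_add_left, real_inner_smul_left, real_inner_smul_right] at h2
  have h3 : s * (inner ℝ y w + s * inner ℝ (B w) w) ≤ 0 := by linarith
  exact nonpos_of_mul_nonpos_right h3 hs

/-- An everywhere defined dissipative operator on a Hilbert space is bounded. -/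
theorem continuous [CompleteSpace F] {B : F →ₗ[ℝ] F} (hB : ∀ x, inner ℝ (B x) x ≤ 0) :
    Continuous B := by
  refine B.continuous_of_seq_closed_graph fun u x y hu hy => ?_
  have h1 : Tendsto (fun n => u n - x) atTop (𝓝 0) := by simpa using hu.sub_const x
  have h2 : Tendsto (fun n => B (u n - x)) atTop (𝓝 (y - B x)) := by
    simp only [map_sub]; exact hy.sub_const _
  have h3 := inner_nonpos_of_tendsto hB h1 h2 (y - B x)
  rw [real_inner_self_nonpos] at h3
  exact sub_eq_zero.mp h3

/-- An injective dissipative operator on a Hilbert space has dense range. -/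
theorem denseRange [CompleteSpace F] {B : F →ₗ[ℝ] F} (hB : ∀ x, inner ℝ (B x) x ≤ 0)
    (hinj : Function.Injective B) : DenseRange B := by
  have h : Dense (LinearMap.range B : Set F) := by
    rw [Submodule.dense_iff_topologicalClosure_eq_top,
      Submodule.topologicalClosure_eq_top_iff, Submodule.eq_bot_iff]
    intro z hz
    have hz' : ∀ x, inner ℝ (B x) z = 0 := fun x => hz _ ⟨x, rfl⟩
    apply hinj
    rw [map_zero]
    -- Since `z` is orthogonal to the range, dissipativity at `z + s • x` retains only `s (⟪B z, x⟫
    -- + s ⟪B x, x⟫)`. The choice `x = B z` below then gives `B z = 0`.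
    have h1 : ∀ x, inner ℝ (B z) x ≤ 0 := fun x => by
      refine nonpos_of_forall_add_mul_nonpos (d := inner ℝ (B x) x) fun s hs => ?_
      have h2 := hB (z + s • x)
      rw [inner_add_smul_self, hz', hz', add_zero, zero_add] at h2
      exact nonpos_of_mul_nonpos_right h2 hs
    have h2 := h1 (B z)
    rwa [real_inner_self_nonpos] at h2
  exact h

/-! ### The integrated equation for a bounded dissipative `B`: uniqueness, regularization,
existence. -/

section Solve

variable {B : F →L[ℝ] F}

/-- Uniqueness for the integrated evolution equation `B U = ∫ U`. -/
theorem eqOn_zero_of_integral_eq (hB : ∀ x, inner ℝ (B x) x ≤ 0) (hinj : Function.Injective B)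
    [CompleteSpace F] {U : ℝ → F} (hU : ContinuousOn U (Ici 0))
    (h : ∀ t : ℝ, 0 ≤ t → B (U t) = ∫ s in (0 : ℝ)..t, U s) : EqOn U 0 (Ici 0) := by
  -- Freezing `U` at its initial value for negative times makes it continuous on the line, so that
  -- its primitive is differentiable everywhere, including at `0`.
  set V : ℝ → F := fun t => U (max t 0) with hV
  have hVc : Continuous V := hU.comp_continuous (by fun_prop) fun t => le_max_right t 0
  have hVU : ∀ t, 0 ≤ t → V t = U t := fun t ht => by rw [hV]; simp only [max_eq_left ht]
  have hint : ∀ t, 0 ≤ t → ∫ s in (0 : ℝ)..t, U s = ∫ s in (0 : ℝ)..t, V s := fun t ht =>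
    intervalIntegral.integral_congr fun s hs => by
      rw [uIcc_of_le ht] at hs; exact (hVU s hs.1).symm
  set w : ℝ → F := fun t => ∫ s in (0 : ℝ)..t, V s with hw
  have hd : ∀ t, HasDerivAt w (V t) t := fun t =>
    intervalIntegral.integral_hasDerivAt_right (hVc.intervalIntegrable _ _)
      (hVc.stronglyMeasurableAtFilter _ _) hVc.continuousAt
  have hd2 : ∀ t, HasDerivAt (fun t => ‖w t‖ ^ 2) (2 * inner ℝ (w t) (V t)) t := fun t =>
    (hd t).norm_sq
  have hanti : AntitoneOn (fun t => ‖w t‖ ^ 2) (Ici 0) := by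
    refine antitoneOn_of_deriv_nonpos (convex_Ici 0)
      (fun t _ => (hd2 t).continuousAt.continuousWithinAt)
      (fun t _ => (hd2 t).differentiableAt.differentiableWithinAt) fun t ht => ?_
    rw [interior_Ici] at ht
    have ht0 : 0 ≤ t := ht.le
    rw [(hd2 t).deriv]
    -- With `w = B V` and `w' = V`, the derivative of `‖w‖²` is `2 ⟪B V, V⟫ ≤ 0`; as `w 0 = 0`, this
    -- forces `w = 0`.
    have e : w t = B (V t) := by rw [hVU t ht0, h t ht0, hint t ht0]
    rw [e]
    linarith [hB (V t)]
  intro t ht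
  have h1 := hanti self_mem_Ici ht ht
  have h0 : w 0 = 0 := intervalIntegral.integral_same
  simp only [h0, norm_zero] at h1
  have h2 : w t = 0 := by
    rw [← norm_eq_zero]
    nlinarith [norm_nonneg (w t)]
  apply hinj
  rw [h t ht, hint t ht]
  simpa using h2

/-- The solutions of two regularized problems are close if the parameters are small. -/
theorem norm_sub_sq_le (hB : ∀ x, inner ℝ (B x) x ≤ 0) {X Y X' Y' : ℝ → F} {δ ε C : ℝ} (hδ : 0 ≤ δ)
    (hε : 0 ≤ ε) (h0 : X 0 = Y 0)
    (hX : ∀ t, HasDerivAt X (X' t) t) (hY : ∀ t, HasDerivAt Y (Y' t) t)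
    (hBX : ∀ t, B (X' t) = X t + δ • X' t) (hBY : ∀ t, B (Y' t) = Y t + ε • Y' t)
    (hX' : ∀ t, 0 ≤ t → ‖X' t‖ ≤ C) (hY' : ∀ t, 0 ≤ t → ‖Y' t‖ ≤ C) {t : ℝ} (ht : 0 ≤ t) :
    ‖X t - Y t‖ ^ 2 ≤ 4 * (δ + ε) * C ^ 2 * t := by
  set K := 4 * (δ + ε) * C ^ 2 with hK
  have hd2 : ∀ t, HasDerivAt (fun t => ‖X t - Y t‖ ^ 2 - K * t)
      (2 * inner ℝ (X t - Y t) (X' t - Y' t) - K) t := fun t => by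
    refine (((hX t).sub (hY t)).norm_sq).sub ?_
    simpa using (hasDerivAt_id t).const_mul K
  have hanti : AntitoneOn (fun t => ‖X t - Y t‖ ^ 2 - K * t) (Ici 0) := by
    refine antitoneOn_of_deriv_nonpos (convex_Ici 0)
      (fun t _ => (hd2 t).continuousAt.continuousWithinAt)
      (fun t _ => (hd2 t).differentiableAt.differentiableWithinAt) fun t ht => ?_
    rw [interior_Ici] at ht
    have ht0 : 0 ≤ t := ht.le
    rw [(hd2 t).deriv]
    -- The `B` part is nonpositive against `X' - Y'`. The remainder has norm at most `(δ + ε) C` and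
    -- meets a factor of norm at most `2 C`; the factor `2` from differentiating the square
    -- completes the constant `K`.
    have e : X t - Y t = B (X' t - Y' t) + (ε • Y' t - δ • X' t) := by
      rw [map_sub, hBX, hBY]; abel
    rw [e, inner_add_left]
    have hC : 0 ≤ C := (norm_nonneg _).trans (hX' t ht0)
    have e1 : ‖X' t - Y' t‖ ≤ 2 * C :=
      (norm_sub_le _ _).trans (by linarith [hX' t ht0, hY' t ht0])
    have e2 : ‖ε • Y' t - δ • X' t‖ ≤ (δ + ε) * C := by
      refine (norm_sub_le _ _).trans ?_
      rw [norm_smul, norm_smul, Real.norm_of_nonneg hε, Real.norm_of_nonneg hδ]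
      nlinarith [hX' t ht0, hY' t ht0]
    have e3 := (real_inner_le_norm (ε • Y' t - δ • X' t) (X' t - Y' t)).trans
      (mul_le_mul e2 e1 (norm_nonneg _) (by positivity))
    have e4 := hB (X' t - Y' t)
    rw [hK]
    nlinarith
  have h1 := hanti self_mem_Ici ht ht
  simp only [h0, sub_self, norm_zero, mul_zero] at h1
  linarith

variable [CompleteSpace F]

/-- The operator `ε - B` is coercive, so Lax–Milgram inverts it, and `G = (B - ε)⁻¹`. For `B = A⁻¹`
this is the Yosida approximation `A (1 - ε A)⁻¹`. The norm of `G` may blow up as `ε → 0`, but that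
of `ε • G` stays at most `1`. -/
theorem exists_inverse_sub_smul (hB : ∀ x, inner ℝ (B x) x ≤ 0) {ε : ℝ} (hε : 0 < ε) :
    ∃ G : F →L[ℝ] F, (∀ x, B (G x) - ε • G x = x) ∧ (∀ x, G (B x) = x + ε • G x) ∧
      (∀ x, ‖ε • G x‖ ≤ ‖x‖) ∧ ∀ x, inner ℝ (G x) x ≤ 0 := by
  set T : F →L[ℝ] F := ε • ContinuousLinearMap.id ℝ F - B with hT
  have hTi : ∀ x, ε * ‖x‖ * ‖x‖ ≤ inner ℝ (T x) x := fun x => by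
    simp only [hT, sub_apply, smul_apply, ContinuousLinearMap.id_apply, inner_sub_left,
      real_inner_smul_left, real_inner_self_eq_norm_mul_norm]
    linarith [hB x]
  have hc : IsCoercive ((innerSL ℝ).comp T : F →L[ℝ] F →L[ℝ] ℝ) := ⟨ε, hε, hTi⟩
  set L := hc.continuousLinearEquivOfBilin
  have hL : ∀ x, L x = T x := fun x => by
    refine ext_inner_right ℝ fun w => ?_
    exact hc.continuousLinearEquivOfBilin_apply x w
  have h1 : ∀ x, T (L.symm x) = x := fun x => by rw [← hL, L.apply_symm_apply]
  have h2 : ∀ x, L.symm (T x) = x := fun x => by rw [← hL, L.symm_apply_apply]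
  have h3 : ∀ x, ε * ‖L.symm x‖ * ‖L.symm x‖ ≤ inner ℝ x (L.symm x) := fun x => by
    have := hTi (L.symm x)
    rwa [h1] at this
  refine ⟨-(L.symm : F →L[ℝ] F), fun x => ?_, fun x => ?_, fun x => ?_, fun x => ?_⟩
  · have := h1 x
    simp only [hT, sub_apply, smul_apply, ContinuousLinearMap.id_apply] at this
    simp only [neg_apply, ContinuousLinearEquiv.coe_coe, map_neg, smul_neg]
    rw [sub_neg_eq_add, neg_add_eq_sub, this]
  · have := h2 x
    simp only [hT, sub_apply, smul_apply, ContinuousLinearMap.id_apply, map_sub, map_smul] at this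
    simp only [neg_apply, ContinuousLinearEquiv.coe_coe, smul_neg]
    nth_rewrite 2 [← this]
    abel
  · simp only [neg_apply, ContinuousLinearEquiv.coe_coe, smul_neg, norm_neg, norm_smul,
      Real.norm_eq_abs, abs_of_pos hε]
    rcases (norm_nonneg (L.symm x)).eq_or_lt with h | h
    · rw [← h, mul_zero]; exact norm_nonneg x
    · exact le_of_mul_le_mul_right ((h3 x).trans (real_inner_le_norm _ _)) h
  · simp only [neg_apply, ContinuousLinearEquiv.coe_coe, inner_neg_left, neg_nonpos]
    rw [real_inner_comm]
    exact le_trans (by positivity) (h3 x)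

/-- The regularized problems `(B - ε) U' = U` are solved by contractions `S`, and their derivatives
`D` are bounded on the range of `B` uniformly in `ε`. -/
theorem exists_regularized (hB : ∀ x, inner ℝ (B x) x ≤ 0) {ε : ℝ} (hε : 0 < ε) :
    ∃ S D : ℝ → F →L[ℝ] F, (∀ x, S 0 x = x) ∧
      (∀ t x, HasDerivAt (fun s => S s x) (D t x) t) ∧
      (∀ t x, 0 ≤ t → ‖S t x‖ ≤ ‖x‖) ∧
      (∀ t x, B (D t x) = S t x + ε • D t x) ∧
      (∀ x, Continuous fun t => D t x) ∧
      ∀ t x, 0 ≤ t → ‖D t (B x)‖ ≤ 2 * ‖x‖ := by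
  obtain ⟨G, hG1, hG2, hG3, hG4⟩ := exists_inverse_sub_smul hB hε
  set S : ℝ → F →L[ℝ] F := fun t => NormedSpace.exp (t • G) with hS
  have hd : ∀ t, HasDerivAt S (S t * G) t := fun t => hasDerivAt_exp_smul_const G t
  -- `G` commutes with its exponential, and both forms of the derivative are needed: `G * S t` for
  -- the energy estimate, `S t * G` for the bound on the range of `B`.
  have hd' : ∀ t, HasDerivAt S (G * S t) t := fun t => hasDerivAt_exp_smul_const' G t
  have hdx : ∀ t x, HasDerivAt (fun s => S s x) (S t (G x)) t := fun t x => by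
    simpa using (hd t).clm_apply (hasDerivAt_const t x)
  have hdx' : ∀ t x, HasDerivAt (fun s => S s x) (G (S t x)) t := fun t x => by
    simpa using (hd' t).clm_apply (hasDerivAt_const t x)
  have hS0 : ∀ x, S 0 x = x := fun x => by simp [hS]
  have hcontr : ∀ t x, 0 ≤ t → ‖S t x‖ ≤ ‖x‖ := by
    intro t x ht
    have hd2 : ∀ t, HasDerivAt (fun t => ‖S t x‖ ^ 2) (2 * inner ℝ (S t x) (G (S t x))) t :=
      fun t => (hdx' t x).norm_sq
    have hanti : AntitoneOn (fun t => ‖S t x‖ ^ 2) (Ici 0) := by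
      refine antitoneOn_of_deriv_nonpos (convex_Ici 0)
        (fun t _ => (hd2 t).continuousAt.continuousWithinAt)
        (fun t _ => (hd2 t).differentiableAt.differentiableWithinAt) fun t _ => ?_
      rw [(hd2 t).deriv, real_inner_comm]
      linarith [hG4 (S t x)]
    have h1 := hanti self_mem_Ici ht ht
    simp only [hS0] at h1
    exact le_of_sq_le_sq h1 (norm_nonneg x)
  refine ⟨S, fun t => S t * G, hS0, hdx, hcontr, fun t x => ?_, fun x => ?_, fun t x ht => ?_⟩
  · have e : S t (G x) = G (S t x) := (hdx t x).unique (hdx' t x)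
    have := hG1 (S t x)
    change B (S t (G x)) = S t x + ε • S t (G x)
    rw [e]
    exact sub_eq_iff_eq_add.mp this
  · exact continuous_iff_continuousAt.mpr fun t => (hdx t (G x)).continuousAt
  · change ‖S t (G (B x))‖ ≤ 2 * ‖x‖
    -- `G (B x) = x + ε • G x` has norm at most `2 ‖x‖` whatever `ε` is.
    rw [hG2]
    refine (hcontr t _ ht).trans ((norm_add_le _ _).trans ?_)
    linarith [hG3 x]

/-- Existence for the integrated evolution equation `B U - B x = ∫ U`. -/
theorem exists_integral_eq (hB : ∀ x, inner ℝ (B x) x ≤ 0) (hinj : Function.Injective B) (x : F) :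
    ∃ U : ℝ → F, ContinuousOn U (Ici 0) ∧
      ∀ t : ℝ, 0 ≤ t → B (U t - x) = ∫ s in (0 : ℝ)..t, U s := by
  set ε : ℕ → ℝ := fun n => 1 / ((n : ℝ) + 1) with hε
  have hε0 : ∀ n, 0 < ε n := fun n => Nat.one_div_pos_of_nat
  have hεt : Tendsto ε atTop (𝓝 0) := tendsto_one_div_add_atTop_nhds_zero_nat
  choose S D hS0 hd hcontr hBD hDc hDB using fun n => exists_regularized hB (hε0 n)
  have hcau : ∀ T : ℝ, UniformCauchySeqOn (fun n t => S n t x) atTop (Icc 0 T) := by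
    intro T
    rw [Metric.uniformCauchySeqOn_iff]
    intro r hr
    -- Derivatives are bounded uniformly in `n` only for initial values `B y`, so `x` is replaced by
    -- a nearby `B y`; contractivity controls the two replacement errors, and each of the three
    -- terms is below `r / 4`.
    obtain ⟨y, hy⟩ := Metric.denseRange_iff.mp (denseRange (B := B.toLinearMap) hB hinj) x (r / 4)
      (by positivity)
    -- The bound with `4 * (ε m + ε n)` is the mean of the bounds with `8 * ε m` and `8 * ε n`, so a
    -- condition on a single index suffices.
    have h1 : Tendsto (fun n => 8 * ε n * (2 * ‖y‖) ^ 2 * |T|) atTop (𝓝 0) := by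
      have := (((hεt.const_mul 8).mul_const ((2 * ‖y‖) ^ 2)).mul_const |T|)
      simpa using this
    obtain ⟨N, hN⟩ := eventually_atTop.mp (h1.eventually (gt_mem_nhds (by positivity : 0 < (r / 4) ^ 2)))
    refine ⟨N, fun m hm n hn t ht => ?_⟩
    have h2 := norm_sub_sq_le hB (hε0 m).le (hε0 n).le (X := fun t => S m t (B y))
      (Y := fun t => S n t (B y)) (C := 2 * ‖y‖) (by simp only [hS0])
      (fun t => hd m t _) (fun t => hd n t _) (fun t => hBD m t _) (fun t => hBD n t _)
      (fun t ht => hDB m t y ht) (fun t ht => hDB n t y ht) ht.1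
    have h3 : ‖S m t (B y) - S n t (B y)‖ < r / 4 := by
      refine lt_of_pow_lt_pow_left₀ 2 (by positivity) (h2.trans_lt ?_)
      have e1 := hN m hm
      have e2 := hN n hn
      have hT : t ≤ |T| := ht.2.trans (le_abs_self T)
      have e3 : 4 * (ε m + ε n) * (2 * ‖y‖) ^ 2 * t ≤ 4 * (ε m + ε n) * (2 * ‖y‖) ^ 2 * |T| :=
        mul_le_mul_of_nonneg_left hT (by have := hε0 m; have := hε0 n; positivity)
      linarith
    have hxy : ‖x - B y‖ < r / 4 := by rw [← dist_eq_norm]; exact hy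
    have h4 := (hcontr m t (x - B y) ht.1).trans_lt hxy
    have h5 := (hcontr n t (x - B y) ht.1).trans_lt hxy
    rw [dist_eq_norm]
    have e : S m t x - S n t x = S m t (x - B y) + (S m t (B y) - S n t (B y))
        - S n t (x - B y) := by
      simp only [map_sub]; abel
    rw [e]
    refine (norm_sub_le _ _).trans_lt ?_
    linarith [norm_add_le (S m t (x - B y)) (S m t (B y) - S n t (B y))]
  -- The condition `0 ≤ t` stands inside the existential so that the choice of limits is a function
  -- on all of `ℝ`; its values at negative times are irrelevant.
  have hlim : ∀ t, ∃ u, 0 ≤ t → Tendsto (fun n => S n t x) atTop (𝓝 u) := by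
    intro t
    by_cases ht : 0 ≤ t
    · obtain ⟨u, hu⟩ := cauchySeq_tendsto_of_complete ((hcau t).cauchy_map (right_mem_Icc.mpr ht))
      exact ⟨u, fun _ => hu⟩
    · exact ⟨0, fun h => absurd h ht⟩
  choose U hU using hlim
  have hSc : ∀ n, Continuous fun t => S n t x := fun n =>
    continuous_iff_continuousAt.mpr fun t => (hd n t x).continuousAt
  have hcont : ContinuousOn U (Ici 0) := by
    intro t ht
    have h1 : TendstoUniformlyOn (fun n t => S n t x) U atTop (Icc 0 (t + 1)) :=
      (hcau (t + 1)).tendstoUniformlyOn_of_tendsto fun s hs => hU s hs.1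
    have h2 : ContinuousOn U (Icc 0 (t + 1)) :=
      h1.continuousOn (Frequently.of_forall fun n => (hSc n).continuousOn)
    have h3 : Ici (0 : ℝ) ∩ Iio (t + 1) ⊆ Icc 0 (t + 1) := fun s hs => ⟨hs.1, hs.2.le⟩
    refine ContinuousWithinAt.mono_of_mem_nhdsWithin
      (h2 t ⟨ht, by linarith⟩) (mem_of_superset ?_ h3)
    exact inter_mem_nhdsWithin _ (Iio_mem_nhds (by linarith))
  refine ⟨U, hcont, fun t ht => ?_⟩
  -- Integrating `B D = S + ε D` in time turns the error into `ε (S - x)`, which tends to `0`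
  -- without any bound on `D n t x`; such a bound is not available for general `x`.
  have happ : ∀ n, B (S n t x - x) = (∫ s in (0 : ℝ)..t, S n s x) + ε n • (S n t x - x) := by
    intro n
    have hDi := (hDc n x).intervalIntegrable (μ := volume) 0 t
    have hDi' : IntervalIntegrable (fun t => ε n • D n t x) volume 0 t := hDi.smul (ε n)
    have e1 : ∫ s in (0 : ℝ)..t, D n s x = S n t x - x := by
      rw [intervalIntegral.integral_eq_sub_of_hasDerivAt (fun s _ => hd n s x) hDi, hS0]
    rw [← e1, ← B.intervalIntegral_comp_comm hDi]
    simp only [hBD]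
    rw [intervalIntegral.integral_add ((hSc n).intervalIntegrable _ _) hDi',
      intervalIntegral.integral_smul]
  have hl : Tendsto (fun n => B (S n t x - x)) atTop (𝓝 (B (U t - x))) :=
    (B.continuous.tendsto _).comp ((hU t ht).sub_const x)
  have hr : Tendsto (fun n => (∫ s in (0 : ℝ)..t, S n s x) + ε n • (S n t x - x)) atTop
      (𝓝 ((∫ s in (0 : ℝ)..t, U s) + (0 : ℝ) • (U t - x))) := by
    refine Tendsto.add ?_ (hεt.smul ((hU t ht).sub_const x))
    refine intervalIntegral.tendsto_integral_filter_of_dominated_convergence (fun _ => ‖x‖)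
      (Eventually.of_forall fun n => (hSc n).aestronglyMeasurable)
      (Eventually.of_forall fun n => ae_of_all _ fun s hs => ?_) intervalIntegrable_const
      (ae_of_all _ fun s hs => ?_)
    · rw [uIoc_of_le ht] at hs
      exact hcontr n s x hs.1.le
    · rw [uIoc_of_le ht] at hs
      exact hU s hs.1.le
  rw [zero_smul, add_zero] at hr
  simp only [happ] at hl
  exact tendsto_nhds_unique hl hr

end Solve

end Dissipative

/-! ### The abstract Cauchy problem -/

namespace Dissipative

open Filter Topology Timoshenko

/-! ### Transport of both results to a space whose norm is only equivalent to a Hilbert norm. -/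

section Transfer

variable {E F : Type*} [NormedAddCommGroup E] [NormedSpace ℝ E] [CompleteSpace E]
  [NormedAddCommGroup F] [InnerProductSpace ℝ F] [CompleteSpace F] {B : E →L[ℝ] E} (e : E ≃L[ℝ] F)

/-- `eqOn_zero_of_integral_eq` for an equivalent norm. -/
theorem eqOn_zero_of_integral_eq_of_equiv (hB : ∀ x, inner ℝ (e (B x)) (e x) ≤ 0)
    (hinj : Function.Injective B) {U : ℝ → E} (hU : ContinuousOn U (Ici 0))
    (h : ∀ t : ℝ, 0 ≤ t → B (U t) = ∫ s in (0 : ℝ)..t, U s) : EqOn U 0 (Ici 0) := by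
  let B' : F →L[ℝ] F := (e : E →L[ℝ] F) ∘L B ∘L (e.symm : F →L[ℝ] E)
  have h1 : EqOn (fun t => e (U t)) 0 (Ici 0) := by
    refine eqOn_zero_of_integral_eq (B := B') (fun x => ?_)
      (e.injective.comp (hinj.comp e.symm.injective)) (e.continuous.comp_continuousOn hU)
      fun t ht => ?_
    · simpa [B'] using hB (e.symm x)
    · have e1 : ∫ s in (0 : ℝ)..t, e (U s) = e (∫ s in (0 : ℝ)..t, U s) := by
        refine (e : E →L[ℝ] F).intervalIntegral_comp_comm ?_
        refine ContinuousOn.intervalIntegrable (hU.mono ?_)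
        rw [uIcc_of_le ht]
        exact Icc_subset_Ici_self
      rw [e1, ← h t ht]
      simp [B']
  intro t ht
  exact e.map_eq_zero_iff.mp (h1 ht)

/-- `exists_integral_eq` for an equivalent norm, with a solution on the whole line. -/
theorem exists_integral_eq_of_equiv (hB : ∀ x, inner ℝ (e (B x)) (e x) ≤ 0)
    (hinj : Function.Injective B) (x : E) :
    ∃ U : ℝ → E, Continuous U ∧
      ∀ t : ℝ, 0 ≤ t → B (U t - x) = ∫ s in (0 : ℝ)..t, U s := by
  let B' : F →L[ℝ] F := (e : E →L[ℝ] F) ∘L B ∘L (e.symm : F →L[ℝ] E)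
  obtain ⟨V, hV, h⟩ := exists_integral_eq (B := B')
    (fun x => by simpa [B'] using hB (e.symm x))
    (e.injective.comp (hinj.comp e.symm.injective)) (e x)
  -- A solution continuous on the whole line spares one-sided derivatives at `0` later.
  have hc : Continuous fun t => V (max t 0) :=
    hV.comp_continuous (by fun_prop) fun t => le_max_right t 0
  have hc' : Continuous fun t => e.symm (V (max t 0)) := e.symm.continuous.comp hc
  refine ⟨fun t => e.symm (V (max t 0)), hc', fun t ht => ?_⟩
  apply e.injective
  have e1 : ∫ s in (0 : ℝ)..t, e (e.symm (V (max s 0))) =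
      e (∫ s in (0 : ℝ)..t, e.symm (V (max s 0))) :=
    (e : E →L[ℝ] F).intervalIntegral_comp_comm (hc'.intervalIntegrable _ _)
  simp only [max_eq_left ht]
  rw [← e1]
  have e2 : ∫ s in (0 : ℝ)..t, e (e.symm (V (max s 0))) = ∫ s in (0 : ℝ)..t, V s := by
    refine intervalIntegral.integral_congr fun s hs => ?_
    rw [uIcc_of_le ht] at hs
    simp only [e.apply_symm_apply, max_eq_left hs.1]
  rw [e2, ← h t ht]
  simp [B']

end Transfer

/-! ### Mild and classical solutions in terms of the bounded inverse. -/

section Cauchy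

variable {E : Type*} [NormedAddCommGroup E] [NormedSpace ℂ E]
  {A : E →ₗ.[ℂ] E} {B : E →L[ℝ] E}

/-- Applying `B = A⁻¹` removes both the unbounded operator and the domain condition: an integral of
the form `B (U t - U₀)` lies in the domain automatically. -/
theorem isMildSolution_iff (hAB : ∀ x, ∃ h : B x ∈ A.domain, A ⟨B x, h⟩ = x)
    (hBA : ∀ x : A.domain, B (A x) = x) {U₀ : E} {U : ℝ → E} :
    IsMildSolution A U₀ U ↔ ContinuousOn U (Ici 0) ∧
      ∀ t : ℝ, 0 ≤ t → B (U t - U₀) = ∫ s in (0 : ℝ)..t, U s := by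
  refine ⟨fun h => ⟨h.1, fun t ht => ?_⟩, fun h => ⟨h.1, fun t ht => ?_⟩⟩
  · obtain ⟨h1, h2⟩ := h.2 t ht
    rw [h2, add_sub_cancel_left, hBA]
  · rw [← h.2 t ht]
    obtain ⟨h1, h2⟩ := hAB (U t - U₀)
    exact ⟨h1, by rw [h2, add_sub_cancel]⟩

/-- A complex linear equivalence, as a real linear one. -/
noncomputable def realEquiv {F : Type*} [NormedAddCommGroup F] [NormedSpace ℂ F] (e : E ≃L[ℂ] F) :
    E ≃L[ℝ] F where
  toLinearEquiv := e.toLinearEquiv.restrictScalars ℝ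
  continuous_toFun := e.continuous
  continuous_invFun := e.symm.continuous

variable {F : Type*} [NormedAddCommGroup F] [InnerProductSpace ℂ F]

/-- A surjective dissipative operator is injective. -/
theorem injective_of_surjective (e : E ≃L[ℂ] F)
    (hdiss : ∀ x : A.domain, (inner ℂ (e (A x)) (e x)).re ≤ 0)
    (hsurj : ∀ y : E, ∃ x : A.domain, A x = y) : Function.Injective A := by
  change Function.Injective A.toFun
  rw [injective_iff_map_eq_zero]
  intro x hx
  have hx' : A x = 0 := hx
  -- With `A x = 0`, dissipativity at `x + s • y` divided by `s` leaves `Re ⟪A y, x⟫ + s Re ⟪A y, y⟫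
  -- ≤ 0`. Surjectivity then permits `A y = x`, whence `x = 0`.
  have h1 : ∀ y : A.domain, (inner ℂ (e (A y)) (e x)).re ≤ 0 := fun y => by
    refine nonpos_of_forall_add_mul_nonpos (d := (inner ℂ (e (A y)) (e y)).re) fun s hs => ?_
    have h2 := hdiss (x + (s : ℂ) • y)
    rw [A.map_add, A.map_smul, hx', zero_add, Submodule.coe_add, Submodule.coe_smul] at h2
    simp only [map_add, map_smul, inner_add_right, inner_smul_left, inner_smul_right,
      Complex.conj_ofReal, Complex.add_re, Complex.re_ofReal_mul] at h2
    have h3 : s * ((inner ℂ (e (A y)) (e x)).re + s * (inner ℂ (e (A y)) (e y)).re) ≤ 0 := by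
      linarith
    exact nonpos_of_mul_nonpos_right h3 hs
  obtain ⟨y, hy⟩ := hsurj x
  have h2 := h1 y
  rw [hy] at h2
  have h3 : e x = 0 := (re_inner_self_nonpos (𝕜 := ℂ)).mp h2
  exact Subtype.ext (e.map_eq_zero_iff.mp h3)

variable [CompleteSpace F]

/-- A surjective operator which is dissipative for an equivalent Hilbert norm has a bounded
inverse. -/
theorem exists_inverse (e : E ≃L[ℂ] F)
    (hdiss : ∀ x : A.domain, (inner ℂ (e (A x)) (e x)).re ≤ 0)
    (hsurj : ∀ y : E, ∃ x : A.domain, A x = y) :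
    ∃ B : E →L[ℝ] E, (∀ x, ∃ h : B x ∈ A.domain, A ⟨B x, h⟩ = x) ∧
      ∀ x : A.domain, B (A x) = x := by
  let : InnerProductSpace ℝ F := InnerProductSpace.rclikeToReal ℂ F
  let L := LinearEquiv.ofBijective A.toFun ⟨injective_of_surjective e hdiss hsurj, hsurj⟩
  let B₀ : E →ₗ[ℝ] E := (A.domain.subtype ∘ₗ (L.symm : E →ₗ[ℂ] A.domain)).restrictScalars ℝ
  have h1 : ∀ x, A (L.symm x) = x := fun x => L.apply_symm_apply x
  have h2 : ∀ x : A.domain, B₀ (A x) = x := fun x => congrArg Subtype.val (L.symm_apply_apply x)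
  let e' : E ≃L[ℝ] F := realEquiv e
  let B' : F →ₗ[ℝ] F := e'.toLinearMap ∘ₗ B₀ ∘ₗ e'.symm.toLinearMap
  -- Dissipativity of `A` at a point `B x` reads `Re ⟪x, B x⟫ ≤ 0`, with `x` in the first slot;
  -- hence the exchange of arguments.
  have hB' : Continuous B' := Dissipative.continuous (B := B') fun x => by
    rw [real_inner_comm, real_inner_eq_re_inner ℂ]
    have := hdiss (L.symm (e.symm x))
    rw [h1, e.apply_symm_apply] at this
    exact this
  have hB₀ : Continuous B₀ := by
    have h3 : ⇑B₀ = e.symm ∘ B' ∘ e := by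
      ext x
      change B₀ x = e.symm (e (B₀ (e.symm (e x))))
      rw [e.symm_apply_apply, e.symm_apply_apply]
    rw [h3]
    exact e.symm.continuous.comp (hB'.comp e.continuous)
  exact ⟨⟨B₀, hB₀⟩, fun x => ⟨(L.symm x).2, h1 x⟩, h2⟩

variable [CompleteSpace E]

/-- Since `U = B (A U) = B U'`, pulling `B` out of the integral gives `∫ U = B ∫ U' = B (U t - U₀)`.
Uniqueness of classical solutions thus reduces to that of mild ones. -/
theorem IsClassicalSolution.isMildSolution (hAB : ∀ x, ∃ h : B x ∈ A.domain, A ⟨B x, h⟩ = x)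
    (hBA : ∀ x : A.domain, B (A x) = x) {U₀ : E} {U : ℝ → E} (h : IsClassicalSolution A U₀ U) :
    IsMildSolution A U₀ U := by
  rw [isMildSolution_iff hAB hBA]
  have hU := h.contDiffOn.continuousOn
  refine ⟨hU, fun t ht => ?_⟩
  set G : ℝ → E := fun s => A ⟨U (max s 0), h.mem_domain _ (le_max_right s 0)⟩ with hG
  have hGc : Continuous G := by
    have h1 : Continuous fun s : ℝ => (⟨max s 0, le_max_right s 0⟩ : Ici (0 : ℝ)) := by fun_prop
    exact (continuous_snd.comp h.continuous_graph).comp h1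
  have hGi := hGc.intervalIntegrable (μ := volume) 0 t
  have hGU : ∀ s, 0 ≤ s → B (G s) = U s := fun s hs => by
    rw [hG, hBA]; simp only [max_eq_left hs]
  have e1 : ∫ s in (0 : ℝ)..t, G s = U t - U 0 := by
    refine intervalIntegral.integral_eq_sub_of_hasDerivAt_of_le ht
      (hU.mono Icc_subset_Ici_self) (fun s hs => ?_) hGi
    have := h.hasDerivAt s hs.1
    simpa only [hG, max_eq_left hs.1.le] using this
  rw [← h.initial, ← e1, ← B.intervalIntegral_comp_comm hGi]
  refine intervalIntegral.integral_congr fun s hs => ?_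
  rw [uIcc_of_le ht] at hs
  exact hGU s hs.1

/-- The primitive of a mild solution is a classical solution. -/
theorem isClassicalSolution_of_integral_eq (hAB : ∀ x, ∃ h : B x ∈ A.domain, A ⟨B x, h⟩ = x)
    {x : E} {X : ℝ → E} (hX : Continuous X)
    (h : ∀ t : ℝ, 0 ≤ t → B (X t - x) = ∫ s in (0 : ℝ)..t, X s) :
    IsClassicalSolution A (B x) fun t => B (X t) := by
  have hA : ∀ (y : E) (hy : B y ∈ A.domain), A ⟨B y, hy⟩ = y := fun y _ => (hAB y).choose_spec
  -- `W` is `C¹` on the whole line with derivative `X`, and agrees with `B X` on `[0, ∞)`; the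
  -- regularity is read off from `W`.
  set W : ℝ → E := fun t => B x + ∫ s in (0 : ℝ)..t, X s with hW
  have hWX : ∀ t, 0 ≤ t → B (X t) = W t := fun t ht => by
    simp only [hW]; rw [← h t ht, map_sub, add_sub_cancel]
  have hd : ∀ t, HasDerivAt W (X t) t := fun t =>
    (intervalIntegral.integral_hasDerivAt_right (hX.intervalIntegrable _ _)
      (hX.stronglyMeasurableAtFilter _ _) hX.continuousAt).const_add _
  have hWd : deriv W = X := funext fun t => (hd t).deriv
  refine ⟨fun t _ => (hAB (X t)).choose, ?_, ?_, fun t ht => ?_, ?_⟩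
  · simp only [hA]
    exact ((B.continuous.comp hX).prodMk hX).comp continuous_subtype_val
  · have h1 : ContDiff ℝ 1 W := by
      rw [contDiff_one_iff_deriv, hWd]
      exact ⟨fun t => (hd t).differentiableAt, hX⟩
    exact h1.contDiffOn.congr fun t ht => hWX t ht
  · rw [hA]
    refine (hd t).congr_of_eventuallyEq ?_
    filter_upwards [Ioi_mem_nhds ht] with s hs
    exact hWX s hs.le
  · have := h 0 le_rfl
    rw [intervalIntegral.integral_same, map_sub, sub_eq_zero] at this
    exact this

/-- Well-posedness of the Cauchy problem for a surjective operator which is dissipative for an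
equivalent Hilbert norm. -/
theorem wellPosed (e : E ≃L[ℂ] F)
    (hdiss : ∀ x : A.domain, (inner ℂ (e (A x)) (e x)).re ≤ 0)
    (hsurj : ∀ y : E, ∃ x : A.domain, A x = y) :
    (∀ U₀ : E, ∃ U : ℝ → E, IsMildSolution A U₀ U ∧
      ∀ V : ℝ → E, IsMildSolution A U₀ V → EqOn V U (Ici 0)) ∧
    ∀ U₀ ∈ A.domain, ∃ U : ℝ → E, IsMildSolution A U₀ U ∧ IsClassicalSolution A U₀ U ∧
      ∀ V : ℝ → E, IsClassicalSolution A U₀ V → EqOn V U (Ici 0) := by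
  let : InnerProductSpace ℝ F := InnerProductSpace.rclikeToReal ℂ F
  obtain ⟨B, hAB, hBA⟩ := exists_inverse e hdiss hsurj
  have hinj : Function.Injective B := by
    intro x y hxy
    obtain ⟨hx, hx'⟩ := hAB x
    obtain ⟨hy, hy'⟩ := hAB y
    rw [← hx', ← hy']
    congr 2
  let e' : E ≃L[ℝ] F := realEquiv e
  have hB : ∀ x, inner ℝ (e' (B x)) (e' x) ≤ 0 := fun x => by
    obtain ⟨hx, hx'⟩ := hAB x
    rw [real_inner_comm, real_inner_eq_re_inner ℂ]
    have := hdiss ⟨B x, hx⟩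
    rw [hx'] at this
    exact this
  have huniq : ∀ (U₀ : E) (U V : ℝ → E), IsMildSolution A U₀ U → IsMildSolution A U₀ V →
      EqOn V U (Ici 0) := by
    intro U₀ U V hU hV t ht
    rw [isMildSolution_iff hAB hBA] at hU hV
    have hi : ∀ {W : ℝ → E}, ContinuousOn W (Ici 0) → ∀ t : ℝ, 0 ≤ t →
        IntervalIntegrable W volume 0 t := fun hW t ht =>
      ContinuousOn.intervalIntegrable (hW.mono (by rw [uIcc_of_le ht]; exact Icc_subset_Ici_self))
    have h1 := eqOn_zero_of_integral_eq_of_equiv e' hB hinj (hV.1.sub hU.1) fun t ht => by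
      have h2 := intervalIntegral.integral_sub (hi hV.1 t ht) (hi hU.1 t ht)
      refine Eq.trans ?_ h2.symm
      rw [← hV.2 t ht, ← hU.2 t ht, ← map_sub, sub_sub_sub_cancel_right, Pi.sub_apply]
    exact sub_eq_zero.mp (h1 ht)
  have hex : ∀ U₀ : E, ∃ U : ℝ → E, IsMildSolution A U₀ U := fun U₀ => by
    obtain ⟨U, hU, h⟩ := exists_integral_eq_of_equiv e' hB hinj U₀
    exact ⟨U, (isMildSolution_iff hAB hBA).mpr ⟨hU.continuousOn, h⟩⟩
  refine ⟨fun U₀ => ?_, fun U₀ hU₀ => ?_⟩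
  · obtain ⟨U, hU⟩ := hex U₀
    exact ⟨U, hU, fun V hV => huniq U₀ U V hU hV⟩
  -- `X` is the future `A U`: it is the mild solution starting at `A U₀`, and `B X` starts at `B (A
  -- U₀) = U₀`.
  · obtain ⟨X, hX, h⟩ := exists_integral_eq_of_equiv e' hB hinj (A ⟨U₀, hU₀⟩)
    have hcl := isClassicalSolution_of_integral_eq hAB hX h
    rw [hBA] at hcl
    have hm := IsClassicalSolution.isMildSolution hAB hBA hcl
    exact ⟨_, hm, hcl, fun V hV =>
      huniq U₀ _ V hm (IsClassicalSolution.isMildSolution hAB hBA hV)⟩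

end Cauchy

end Dissipative

/-! ### Integration by parts in `H¹(0, 1)` -/

namespace Timoshenko

/-- The constant functions in `H¹(0, 1)`. -/
noncomputable def H1.const (c : ℂ) : H1 := ⟨(ContinuousMap.const _ c, 0), by
  intro φ hφ
  have h1 : ∀ x, ext (ContinuousMap.const _ c) x = c := fun x => rfl
  have h2 : ∫ x in Ioo (0 : ℝ) 1, φ x • (0 : L2) x = 0 := by
    rw [← integral_zero ℝ ℂ (μ := volume.restrict (Ioo (0 : ℝ) 1))]
    apply integral_congr_ae
    filter_upwards [Lp.coeFn_zero ℂ 2 (volume.restrict (Ioo (0 : ℝ) 1))] with x hx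
    rw [hx]; simp
  have hz : ∀ x, x ∉ Ioo (0 : ℝ) 1 → φ x = 0 := fun x hx =>
    image_eq_zero_of_notMem_tsupport fun h => hx (hφ.2.2 h)
  simp only [h1, h2]
  rw [integral_smul_const, ← integral_Ioc_eq_integral_Ioo,
    ← intervalIntegral.integral_of_le zero_le_one,
    intervalIntegral.integral_deriv_eq_sub
      (fun x _ => (hφ.1.differentiable (by simp)).differentiableAt)
      (hφ.continuous_deriv.intervalIntegrable _ _), hz 0 (by simp), hz 1 (by simp)]
  simp⟩

theorem H1.wderiv_const (c : ℂ) : H1.wderiv (H1.const c) = 0 := rfl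

theorem H1.eval_const (x : Icc (0 : ℝ) 1) (c : ℂ) : H1.eval x (H1.const c) = c := rfl

/-- An `H¹` function is determined by its derivative and its value at `1`, which are arbitrary. -/
theorem H1.exists_wderiv_eq_eval_one_eq (g : L2) (c : ℂ) :
    ∃ f : H1, H1.wderiv f = g ∧ H1.eval 1 f = c := by
  obtain ⟨f, hf⟩ := H1L.exists_wderiv_eq g
  refine ⟨f + H1.const (c - H1.eval 1 f), ?_, ?_⟩
  · rw [map_add, hf, H1.wderiv_const, add_zero]
  · rw [map_add, H1.eval_const, add_sub_cancel]

/-- The difference of `f` and the primitive of its weak derivative has zero weak derivative, hence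
is constant. -/
theorem H1.eval_eq_eval_zero_add (f : H1) (x : Icc (0 : ℝ) 1) :
    H1.eval x f = H1.eval 0 f + ∫ t in Ioo (0 : ℝ) x, H1.wderiv f t := by
  let P : H1 := (⟨(primitive (H1.wderiv f), H1.wderiv f), hasWeakDeriv_primitive _⟩ : H1.graph)
  have hP : ∀ x, H1.eval x P = ∫ t in Ioo (0 : ℝ) x, H1.wderiv f t := fun x => rfl
  obtain ⟨c, hc⟩ := (f - P).eq_const_of_wderiv_eq_zero (by rw [map_sub]; exact sub_self _)
  have hc' : ∀ x, H1.eval x f - H1.eval x P = c := fun x => by rw [← map_sub]; exact hc x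
  have h0 := hc' 0
  have h1 : H1.eval 0 P = 0 := by
    rw [hP]
    change ∫ t in Ioo (0 : ℝ) 0, _ = _
    simp
  rw [h1, sub_zero] at h0
  rw [h0, ← hP, ← hc' x, sub_add_cancel]

theorem H1.eval_eq_eval_one_sub (f : H1) (x : Icc (0 : ℝ) 1) :
    H1.eval x f = H1.eval 1 f - ∫ t in Ioo (x : ℝ) 1, H1.wderiv f t := by
  have h : (∫ t in Ioo (0 : ℝ) 1, H1.wderiv f t) = (∫ t in Ioo (0 : ℝ) x, H1.wderiv f t)
      + ∫ t in Ioo (x : ℝ) 1, H1.wderiv f t := by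
    have hi := integrable_L2 (H1.wderiv f)
    simp only [← integral_Ioc_eq_integral_Ioo]
    rw [← Ioc_union_Ioc_eq_Ioc x.2.1 x.2.2]
    have hi' : IntegrableOn (H1.wderiv f) (Ioc 0 1) := by
      rwa [IntegrableOn, ← restrict_Ioo_eq_restrict_Ioc]
    exact setIntegral_union (Ioc_disjoint_Ioc_of_le le_rfl) measurableSet_Ioc
      (hi'.mono_set (Ioc_subset_Ioc_right x.2.2)) (hi'.mono_set (Ioc_subset_Ioc_left x.2.1))
  rw [H1.eval_eq_eval_zero_add f x, H1.eval_eq_eval_zero_add f 1]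
  change _ = _ + (∫ t in Ioo (0 : ℝ) 1, H1.wderiv f t) - _
  rw [h]; ring

theorem H1.toL2_coe (f : H1) :
    H1.toL2 f =ᵐ[volume.restrict (Ioo (0 : ℝ) 1)] ext f.1.1 := contToL2_coe f.1.1

/-- Interchange of the integrals over a triangle. -/
theorem integral_mul_integral_Ioo_swap {h k : ℝ → ℂ}
    (hh : Integrable h (volume.restrict (Ioo (0 : ℝ) 1)))
    (hk : Integrable k (volume.restrict (Ioo (0 : ℝ) 1))) :
    ∫ x in Ioo (0 : ℝ) 1, h x * ∫ t in Ioo (0 : ℝ) x, k t =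
      ∫ t in Ioo (0 : ℝ) 1, k t * ∫ x in Ioo t 1, h x := by
  set μ : Measure ℝ := volume.restrict (Ioo (0 : ℝ) 1) with hμ
  have hint : Integrable (fun q : ℝ × ℝ =>
      indicator {q : ℝ × ℝ | q.2 < q.1} (fun q => h q.1 * k q.2) q) (μ.prod μ) :=
    Integrable.indicator (hh.mul_prod hk) (measurableSet_lt measurable_snd measurable_fst)
  have hswap := integral_integral_swap (f := fun x t =>
      indicator {q : ℝ × ℝ | q.2 < q.1} (fun q => h q.1 * k q.2) (x, t)) hint
  have hl : ∀ x ∈ Ioo (0 : ℝ) 1, ∫ t, indicator {q : ℝ × ℝ | q.2 < q.1}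
      (fun q => h q.1 * k q.2) (x, t) ∂μ = h x * ∫ t in Ioo (0 : ℝ) x, k t := by
    intro x hx
    have e1 : ∀ t, indicator {q : ℝ × ℝ | q.2 < q.1} (fun q => h q.1 * k q.2) (x, t)
        = indicator (Iio x) (fun t => h x * k t) t := fun t => rfl
    have e2 : Iio x ∩ Ioo 0 1 = Ioo 0 x := by
      ext t
      exact ⟨fun h => ⟨h.2.1, h.1⟩, fun h => ⟨h.2, h.1, h.2.trans hx.2⟩⟩
    simp only [e1]
    rw [integral_indicator measurableSet_Iio, hμ, Measure.restrict_restrict measurableSet_Iio,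
      integral_const_mul, e2]
  have hr : ∀ t ∈ Ioo (0 : ℝ) 1, ∫ x, indicator {q : ℝ × ℝ | q.2 < q.1}
      (fun q => h q.1 * k q.2) (x, t) ∂μ = k t * ∫ x in Ioo t 1, h x := by
    intro t ht
    have e1 : ∀ x, indicator {q : ℝ × ℝ | q.2 < q.1} (fun q => h q.1 * k q.2) (x, t)
        = indicator (Ioi t) (fun x => h x * k t) x := fun t => rfl
    have e2 : Ioi t ∩ Ioo 0 1 = Ioo t 1 := by
      ext x
      exact ⟨fun h => ⟨h.1, h.2.2⟩, fun h => ⟨h.1, ht.1.trans h.1, h.2⟩⟩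
    simp only [e1]
    rw [integral_indicator measurableSet_Ioi, hμ, Measure.restrict_restrict measurableSet_Ioi,
      integral_mul_const, e2, mul_comm]
  rw [← setIntegral_congr_fun measurableSet_Ioo hl, hswap,
    setIntegral_congr_fun measurableSet_Ioo hr]

/-- Integration by parts. -/
theorem inner_toL2_wderiv_add {f g : H1} (hg : g ∈ H1L) :
    inner ℂ (H1.toL2 g) (H1.wderiv f) + inner ℂ (H1.wderiv g) (H1.toL2 f) =
      H1.eval 1 f * conj (H1.eval 1 g) := by
  have hg0 : H1.eval 0 g = 0 := hg
  have hif := integrable_L2 (H1.wderiv f)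
  have hig : Integrable (fun x => conj (H1.wderiv g x)) (volume.restrict (Ioo (0 : ℝ) 1)) :=
    Complex.conjCLE.toContinuousLinearMap.integrable_comp (integrable_L2 (H1.wderiv g))
  have hconj : ∀ s : Set ℝ, ∫ x in s, conj (H1.wderiv g x) = conj (∫ x in s, H1.wderiv g x) :=
    fun s => integral_conj
  -- `g` is written as an integral from `0`, where it vanishes, and `f` as `f(1)` minus an integral
  -- up to `1`. The two resulting double integrals over the triangle `t < x` cancel, leaving `f(1) ∫
  -- conj g'`.
  have h1 : inner ℂ (H1.toL2 g) (H1.wderiv f) =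
      ∫ x in Ioo (0 : ℝ) 1, H1.wderiv f x * ∫ t in Ioo (0 : ℝ) x, conj (H1.wderiv g t) := by
    rw [L2.inner_def]
    refine integral_congr_ae ?_
    filter_upwards [H1.toL2_coe g, ae_restrict_mem measurableSet_Ioo] with x hx hx'
    rw [RCLike.inner_apply, hx, ext_of_mem _ (Ioo_subset_Icc_self hx'), hconj]
    have := H1.eval_eq_eval_zero_add g ⟨x, Ioo_subset_Icc_self hx'⟩
    rw [hg0, zero_add] at this
    rw [← this]
    rfl
  have h2 : inner ℂ (H1.wderiv g) (H1.toL2 f) =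
      ∫ t in Ioo (0 : ℝ) 1, (H1.eval 1 f * conj (H1.wderiv g t) -
        conj (H1.wderiv g t) * ∫ x in Ioo t 1, H1.wderiv f x) := by
    rw [L2.inner_def]
    refine integral_congr_ae ?_
    filter_upwards [H1.toL2_coe f, ae_restrict_mem measurableSet_Ioo] with x hx hx'
    rw [RCLike.inner_apply, hx, ext_of_mem _ (Ioo_subset_Icc_self hx')]
    have := H1.eval_eq_eval_one_sub f ⟨x, Ioo_subset_Icc_self hx'⟩
    change H1.eval ⟨x, Ioo_subset_Icc_self hx'⟩ f * _ = _
    rw [this]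
    ring
  have hi2 : Integrable (fun t => conj (H1.wderiv g t) * ∫ x in Ioo t 1, H1.wderiv f x)
      (volume.restrict (Ioo (0 : ℝ) 1)) := by
    -- The inner integral equals `f(1) - f(t)`, which is bounded.
    have h3 : Integrable (fun t => conj (H1.wderiv g t) * (H1.eval 1 f - ext f.1.1 t))
        (volume.restrict (Ioo (0 : ℝ) 1)) := by
      refine hig.mul_bdd (c := ‖H1.eval 1 f‖ + ‖f.1.1‖)
        (continuous_const.sub (continuous_ext _)).aestronglyMeasurable (ae_of_all _ fun x => ?_)
      exact (norm_sub_le _ _).trans (add_le_add_right (f.1.1.norm_coe_le_norm _) _)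
    refine h3.congr ?_
    filter_upwards [ae_restrict_mem measurableSet_Ioo] with x hx
    have := H1.eval_eq_eval_one_sub f ⟨x, Ioo_subset_Icc_self hx⟩
    rw [ext_of_mem _ (Ioo_subset_Icc_self hx)]
    change _ * (_ - H1.eval ⟨x, Ioo_subset_Icc_self hx⟩ f) = _
    rw [this]
    ring
  rw [h1, h2, integral_sub (hig.const_mul _) hi2, integral_mul_integral_Ioo_swap hif hig,
    add_sub_cancel, integral_const_mul, hconj]
  have := H1.eval_eq_eval_zero_add g 1
  rw [hg0, zero_add] at this
  rw [this]
  rfl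

/-! ### The operator is dissipative for an equivalent inner product, and surjective -/

/-- The components of the elements of the energy space do not depend on the constants. -/
noncomputable def EnergySpace.changeParams (p q : Params) : EnergySpace p ≃ₗ[ℂ] EnergySpace q where
  toFun U := ⟨U.u, U.v, U.y, U.z, U.η, U.γ⟩
  invFun U := ⟨U.u, U.v, U.y, U.z, U.η, U.γ⟩
  map_add' _ _ := rfl
  map_smul' _ _ := rfl
  left_inv _ := rfl
  right_inv _ := rfl

/-- Only the weight of `γ` changes, by the factor `r = p.k₃ / q.k₃`, and `1 + r` dominates both `1`
and `r`. The hypotheses are symmetric in `p` and `q`, so the bound serves for both directions of the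
equivalence. -/
theorem EnergySpace.norm_changeParams_le {p q : Params} (ha : q.a = p.a) (hb : q.b = p.b)
    (hk : q.k₁ = p.k₁) (U : EnergySpace p) :
    ‖changeParams p q U‖ ≤ √(1 + p.k₃ / q.k₃) * ‖U‖ := by
  have ha' := p.a_pos
  have hb' := p.b_pos
  have h1 := p.k₁_pos
  have h3 := p.k₃_pos
  have h3' := q.k₃_pos
  rw [← Real.sqrt_sq (norm_nonneg U), ← Real.sqrt_mul (by positivity)]
  apply Real.le_sqrt_of_sq_le
  rw [norm_sq_eq, norm_sq_eq, ha, hb, hk]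
  change ‖U.v‖ ^ 2 + p.b⁻¹ * ‖U.z‖ ^ 2 + p.a * p.b⁻¹ * ‖H1.wderiv U.y‖ ^ 2 + ‖U.shear‖ ^ 2
      + p.k₁⁻¹ * ‖U.η‖ ^ 2 + q.k₃⁻¹ * ‖U.γ‖ ^ 2 ≤ _
  have e : q.k₃⁻¹ = p.k₃ / q.k₃ * p.k₃⁻¹ := by field_simp
  have hr : 0 ≤ p.k₃ / q.k₃ := by positivity
  set r := p.k₃ / q.k₃
  rw [e, add_mul, one_mul, mul_assoc r]
  have hγ : 0 ≤ p.k₃⁻¹ * ‖U.γ‖ ^ 2 := by positivity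
  set A := ‖U.v‖ ^ 2 + p.b⁻¹ * ‖U.z‖ ^ 2 + p.a * p.b⁻¹ * ‖H1.wderiv U.y‖ ^ 2 + ‖U.shear‖ ^ 2
      + p.k₁⁻¹ * ‖U.η‖ ^ 2 with hA
  have hA0 : 0 ≤ A := by positivity
  nlinarith [mul_nonneg hr hA0]

/-- The parameters whose energy is dissipated by the evolution with the parameters `p`. -/
noncomputable def Params.rescale (p : Params) : Params where
  a := p.a
  b := p.b
  k₁ := p.k₁
  k₂ := p.k₂
  -- With this weight the load term `-k₃ y_x(1) conj γ` becomes `-(a/b) y_x(1) conj z(1)`, the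
  -- negative of the boundary term from integrating `(a/b) y_xx conj z` by parts.
  k₃ := p.k₃ * p.b / p.a
  k₄ := p.k₄
  a_pos := p.a_pos
  b_pos := p.b_pos
  k₁_pos := p.k₁_pos
  k₂_pos := p.k₂_pos
  k₃_pos := div_pos (mul_pos p.k₃_pos p.b_pos) p.a_pos
  k₄_pos := p.k₄_pos

/-- The energy norms of `p` and of `p.rescale` are equivalent. -/
noncomputable def EnergySpace.rescaleEquiv (p : Params) : EnergySpace p ≃L[ℂ] EnergySpace p.rescale :=
  (changeParams p p.rescale).toContinuousLinearEquivOfBounds _ _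
    (norm_changeParams_le rfl rfl rfl) (norm_changeParams_le (p := p.rescale) (q := p) rfl rfl rfl)

/-- With `s = u_x + y` and `q = y_x`, integration by parts pairs `s` with `v` and `q` with `z`. The
coupling terms in `s` and `z` have opposite real parts, the boundary terms cancel against the loads,
and only the damping terms in `k₂` and `k₄` survive. -/
theorem beamOperator_dissipative {p : Params} (U : (beamOperator p).domain) :
    (inner ℂ (EnergySpace.rescaleEquiv p (beamOperator p U))
      (EnergySpace.rescaleEquiv p U)).re ≤ 0 := by
  have ha := p.a_pos
  have hb := p.b_pos
  have h1 := p.k₁_pos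
  have h2 := p.k₂_pos
  have h3 := p.k₃_pos
  have h4 := p.k₄_pos
  change domain p at U
  set v := domain.v U with hv
  set z := domain.z U with hz
  set s : H1 := H2.dx (domain.u U) + (domain.y U : H1) with hs
  set q : H1 := H2.dx (domain.y U) with hq
  have hvL : H1.toL2 v = U.1.v := domain.toL2_v U
  have hzL : H1.toL2 z = U.1.z := domain.toL2_z U
  have hη : U.1.η = H1.eval 1 v := by
    obtain ⟨w, -, hw, hw'⟩ := U.2.2.2.1
    rw [hw', H1.toL2_injective (hw.trans hvL.symm)]
  have hγ : U.1.γ = H1.eval 1 z := by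
    obtain ⟨w, -, hw, hw'⟩ := U.2.2.2.2
    rw [hw', H1.toL2_injective (hw.trans hzL.symm)]
  have hsL : H1.toL2 s = U.1.shear := by rw [hs, map_add, H2.toL2_dx]; rfl
  have hqL : H1.toL2 q = H1.wderiv U.1.y := H2.toL2_dx _
  have e1 := inner_toL2_wderiv_add (f := s) v.2
  have e2 := inner_toL2_wderiv_add (f := q) z.2
  have key : inner ℂ (EnergySpace.rescaleEquiv p (beamOperator p U))
      (EnergySpace.rescaleEquiv p U) =
      inner ℂ (H1.wderiv s) U.1.v
      + (p.b : ℂ)⁻¹ * inner ℂ ((p.a : ℂ) • H1.wderiv q - (p.b : ℂ) • H1.toL2 s) U.1.z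
      + (p.a : ℂ) * (p.b : ℂ)⁻¹ * inner ℂ (H1.wderiv z) (H1.wderiv U.1.y)
      + inner ℂ (H1.wderiv v + H1.toL2 z) U.1.shear
      + (p.k₁ : ℂ)⁻¹ * (U.1.η * conj (-p.k₁ * (H1.eval 1 (H2.dx (domain.u U))
          + H1.eval 1 (domain.y U)) - p.k₂ * U.1.η))
      + ((p.k₃ * p.b / p.a : ℝ) : ℂ)⁻¹ *
        (U.1.γ * conj (-p.k₃ * H1.eval 1 q - p.k₄ * U.1.γ)) := rfl
  rw [key, ← map_add (H1.eval 1), ← hs, ← hvL, ← hzL, ← hsL, ← hqL, hη, hγ]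
  simp only [inner_sub_left, inner_add_left, inner_smul_left, Complex.conj_ofReal]
  -- The inner products are oriented so that each conjugate pair becomes one complex variable; what
  -- remains is algebra of real and imaginary parts.
  rw [← inner_conj_symm (H1.wderiv s), ← inner_conj_symm (H1.wderiv q),
    ← inner_conj_symm (H1.toL2 s)]
  have r1 := congrArg Complex.re e1
  have r2 := congrArg Complex.re e2
  generalize inner ℂ (H1.toL2 v) (H1.wderiv s) = x1 at *
  generalize inner ℂ (H1.wderiv v) (H1.toL2 s) = x2 at *
  generalize inner ℂ (H1.toL2 z) (H1.wderiv q) = x3 at *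
  generalize inner ℂ (H1.wderiv z) (H1.toL2 q) = x4 at *
  generalize inner ℂ (H1.toL2 z) (H1.toL2 s) = x5 at *
  generalize H1.eval 1 v = η at *
  generalize H1.eval 1 z = γ at *
  generalize H1.eval 1 s = s1 at *
  generalize H1.eval 1 q = q1 at *
  simp only [← Complex.ofReal_inv, ← Complex.ofReal_neg, ← Complex.ofReal_mul, Complex.add_re,
    Complex.sub_re, Complex.sub_im, Complex.im_ofReal_mul, map_sub, map_mul,
    Complex.conj_ofReal, Complex.mul_re, Complex.conj_re, Complex.conj_im,
    Complex.ofReal_re, Complex.ofReal_im, zero_mul, sub_zero] at r1 r2 ⊢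
  have d1 : 0 ≤ p.k₂ / p.k₁ * (η.re ^ 2 + η.im ^ 2) := by positivity
  have d2 : 0 ≤ p.a * p.k₄ / (p.b * p.k₃) * (γ.re ^ 2 + γ.im ^ 2) := by positivity
  rw [eq_sub_of_add_eq r1, eq_sub_of_add_eq r2]
  refine le_of_eq_of_le (b := -(p.k₂ / p.k₁ * (η.re ^ 2 + η.im ^ 2))
    - p.a * p.k₄ / (p.b * p.k₃) * (γ.re ^ 2 + γ.im ^ 2)) ?_ (by linarith)
  field_simp
  ring

/-- The system is triangular. `v`, `z`, `η`, `γ` are read off from `W.u` and `W.y`; then the shear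
`s` and `q = y_x` are found from their derivatives and their values at `1`, which the last two
equations prescribe; finally `y` and `u` are primitives of `q` and `s - y` vanishing at `0`. -/
theorem beamOperator_surjective {p : Params} (W : EnergySpace p) :
    ∃ U : (beamOperator p).domain, beamOperator p U = W := by
  have ha : (p.a : ℂ) ≠ 0 := Complex.ofReal_ne_zero.mpr p.a_pos.ne'
  have h1 : (p.k₁ : ℂ) ≠ 0 := Complex.ofReal_ne_zero.mpr p.k₁_pos.ne'
  have h3 : (p.k₃ : ℂ) ≠ 0 := Complex.ofReal_ne_zero.mpr p.k₃_pos.ne'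
  obtain ⟨s, hs, hs1⟩ := H1.exists_wderiv_eq_eval_one_eq W.v
    (-(W.η + p.k₂ * H1.eval 1 W.u) / p.k₁)
  obtain ⟨q, hq, hq1⟩ := H1.exists_wderiv_eq_eval_one_eq
    ((p.a : ℂ)⁻¹ • (W.z + (p.b : ℂ) • H1.toL2 s)) (-(W.γ + p.k₄ * H1.eval 1 W.y) / p.k₃)
  obtain ⟨y, hy⟩ := H1L.exists_wderiv_eq (H1.toL2 q)
  obtain ⟨u, hu⟩ := H1L.exists_wderiv_eq (H1.toL2 (s - y))
  let U : domain p := ⟨⟨u, H1.toL2 W.u, y, H1.toL2 W.y, H1.eval 1 W.u, H1.eval 1 W.y⟩,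
    ⟨_, hu.symm⟩, ⟨_, hy.symm⟩, ⟨_, W.u.2, rfl, rfl⟩, ⟨_, W.y.2, rfl, rfl⟩⟩
  have hdu : H2.dx (domain.u U) = s - y := H1.toL2_injective ((H2.toL2_dx _).trans hu)
  have hdy : H2.dx (domain.y U) = q := H1.toL2_injective ((H2.toL2_dx _).trans hy)
  have hv : domain.v U = W.u := Subtype.ext (H1.toL2_injective (domain.toL2_v U))
  have hz : domain.z U = W.y := Subtype.ext (H1.toL2_injective (domain.toL2_z U))
  have hyU : (domain.y U : H1) = y := rfl
  refine ⟨U, EnergySpace.ext hv ?_ hz ?_ ?_ ?_⟩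
  · change H1.wderiv (H2.dx (domain.u U) + (domain.y U : H1)) = W.v
    rw [hdu, hyU, sub_add_cancel, hs]
  · change (p.a : ℂ) • H1.wderiv (H2.dx (domain.y U))
      - (p.b : ℂ) • H1.toL2 (H2.dx (domain.u U) + (domain.y U : H1)) = W.z
    rw [hdu, hyU, sub_add_cancel, hdy, hq, smul_inv_smul₀ ha, add_sub_cancel_right]
  · change -(p.k₁ : ℂ) * (H1.eval 1 (H2.dx (domain.u U)) + H1.eval 1 (domain.y U))
      - p.k₂ * H1.eval 1 W.u = W.η
    rw [← map_add, hdu, hyU, sub_add_cancel, hs1]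
    field_simp
    ring
  · change -(p.k₃ : ℂ) * H1.eval 1 (H2.dx (domain.y U)) - p.k₄ * H1.eval 1 W.y = W.γ
    rw [hdy, hq1]
    field_simp
    ring

end Timoshenko

theorem theorem2p3 (p : Timoshenko.Params) :
    (∀ U₀ : Timoshenko.EnergySpace p, ∃ U : ℝ → Timoshenko.EnergySpace p,
      Timoshenko.IsMildSolution (Timoshenko.beamOperator p) U₀ U ∧
      ∀ V : ℝ → Timoshenko.EnergySpace p,
        Timoshenko.IsMildSolution (Timoshenko.beamOperator p) U₀ V → Set.EqOn V U (Set.Ici 0)) ∧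
    (∀ U₀ ∈ (Timoshenko.beamOperator p).domain, ∃ U : ℝ → Timoshenko.EnergySpace p,
      Timoshenko.IsMildSolution (Timoshenko.beamOperator p) U₀ U ∧
      Timoshenko.IsClassicalSolution (Timoshenko.beamOperator p) U₀ U ∧
      ∀ V : ℝ → Timoshenko.EnergySpace p,
        Timoshenko.IsClassicalSolution (Timoshenko.beamOperator p) U₀ V →
          Set.EqOn V U (Set.Ici 0)) :=
  Dissipative.wellPosed (Timoshenko.EnergySpace.rescaleEquiv p)
    Timoshenko.beamOperator_dissipative Timoshenko.beamOperator_surjective
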